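/- **Density evolution of Gamma network codes.** *Code.* Let $g\ge 1$, and let $P(x)=\sum_{d=2}^{D}p_dx^d$ with $p_d\ge 0$ and $\sum_d p_d=1$. A random code over $\mathrm{GF}(q)$ has $N=ng$ outer coded packets, split into $n$ generations of $g$ packets, and $K\le N$ information packets. Its outer code has $N-K$ independent random check equations. Each of them has degree $d$ with probability $p_d$; given $d$, it is connected to a uniformly random set $S$ of $d$ generations, and it reads $\sum_{v\in S}\sum_{j=1}^{g}\alpha^{(v)}_ju^{(v)}_j=0$, where $u^{(v)}_1,\dots,u^{(v)}_g$ are the packets of generation $v$ and the coefficients $\alpha^{(v)}_j$ are independent and uniform in $\mathrm{GF}(q)$. Independently, the receiver has $m$ independent packets, each a linear combination, with a uniform coefficient vector in $\mathrm{GF}(q)^g$, of the $g$ packets of a uniformly random generation. *Decoder.* After iteration $0$ the linear system of a generation consists of its received packets. In each further iteration, all generations whose system has full rank $g$ are deleted from all check equations, and then each check equation left with exactly one generation is added to the system of that generation. Let $X_i$ be the expected fraction of full rank generations after iteration $i$. Let $Y_i$ be the expected number of check equations which the deletion of the generations that are of full rank after iteration $i$ reduces to degree one, and which were not reduced to degree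 one before. These $Y_i$ equations all belong to non-full-rank generations, and they count as $Y_i/(1-X_i)$ *effective* received packets, spread uniformly over all generations. The average effective number of packets received from the outer code up to iteration $i$ is thus $E_i=\sum_{j<i}Y_j/(1-X_j)$. *Theorem.* Let $\Gamma_g(x)=(g-1)!\,e^{-x}\sum_{j=0}^{g-1}x^j/j!$. Along any sequence of such codes with $n\to\infty$, $q\to\infty$, $m/n\to r_0$ and $K/N\to R$, the limits $x_i=\lim X_i$ exist for all $i\ge 0$, and $$x_0=1-\frac{\Gamma_g(r_0)}{(g-1)!},\qquad x_i=1-\frac{\Gamma_g\bigl(r_0+g(1-R)P'(x_{i-1})\bigr)}{(g-1)!}\quad(i\ge 1).$$ Moreover, for every $i\ge 1$, the average effective number $E_i$ is asymptotically $ng(1-R)P'(x_{i-1})$, and the corresponding number $E_i(1-X_i)$, that is, $E_i$ times the average fraction of generations that are not of full rank after iteration $i$, is asymptotically $ng(1-R)P'(x_{i-1})(1-x_i)$: $$\lim\frac{E_i}{n}=g(1-R)P'(x_{i-1}),\qquad \lim\frac{E_i(1-X_i)}{n}=g(1-R)P'(x_{i-1})(1-x_i).$$ -/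

import Mathlib

open Filter Topology Polynomial

namespace GammaCode

/-- The incomplete Gamma function at a positive integer `a`:
`Γ_a(x) = (a-1)! e^{-x} ∑_{j=0}^{a-1} x^j / j!`. -/
noncomputable def incGamma (a : ℕ) (x : ℝ) : ℝ :=
  (a - 1).factorial * Real.exp (-x) * ∑ j ∈ Finset.range a, x ^ j / j.factorial

/-- A received packet: the index of its generation among the `n` generations, and its vector of
coefficients with respect to the `g` outer coded packets of that generation. -/
abbrev Packet (n g : ℕ) (F : Type*) : Type _ := Fin n × (Fin g → F)

/-- A check equation of the outer code: the set `S` of generations connected to it, and the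
coefficients `α` of `∑_{v ∈ S} ∑_j α v j * u v j = 0` (the values `α v` with `v ∉ S` are unused). -/
abbrev Check (n g : ℕ) (F : Type*) : Type _ := Finset (Fin n) × (Fin n → Fin g → F)

/-- An outcome of the random experiment: `m` received packets and `M` check equations. -/
abbrev Sample (n g m M : ℕ) (F : Type*) : Type _ :=
  (Fin m → Packet n g F) × (Fin M → Check n g F)

section Decoder

variable {n g m M : ℕ} {F : Type*} [Field F]

open Classical in
/-- The generations whose linear equation system (with row space `W v`) is of full rank `g`. -/
noncomputable def fullRankOf (W : Fin n → Submodule F (Fin g → F)) : Finset (Fin n) :=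
  Finset.univ.filter fun v => Module.finrank F (W v) = g

/-- The row space of the linear equation system of each generation after iteration `i` of the
decoder. After iteration `0` the system consists of the received packets of the generation. In each
further iteration, the full rank generations are first deleted from all check equations; then
each check equation with exactly one remaining generation `v` is added to the system of `v`. -/
noncomputable def rowSpace (ω : Sample n g m M F) : ℕ → Fin n → Submodule F (Fin g → F)
  | 0, v => Submodule.span F {b | ∃ j, ω.1 j = (v, b)}
  | i + 1, v => rowSpace ω i v ⊔
      Submodule.span F {a | ∃ c, (ω.2 c).1 \ fullRankOf (rowSpace ω i) = {v} ∧ a = (ω.2 c).2 v}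

/-- The set of full rank generations after iteration `i`. -/
noncomputable def fullRank (ω : Sample n g m M F) (i : ℕ) : Finset (Fin n) :=
  fullRankOf (rowSpace ω i)

/-- The degree of the check equation `c` once the generations that are of full rank after
iteration `i` are deleted. -/
noncomputable def residualDegree (ω : Sample n g m M F) (i : ℕ) (c : Fin M) : ℕ :=
  ((ω.2 c).1 \ fullRank ω i).card

open Classical in
/-- The number `y_i` of check equations which the deletion of the generations that are of full rank
after iteration `i` reduces to degree one, and which were not reduced to degree one before. -/
noncomputable def newDegreeOne (ω : Sample n g m M F) (i : ℕ) : ℕ :=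
  (Finset.univ.filter fun c : Fin M =>
    residualDegree ω i c = 1 ∧ ∀ j < i, residualDegree ω j c ≠ 1).card

end Decoder

/-! The received packets and the check equations are mutually independent. -/

section Probability

variable (n g m M : ℕ) (P : ℝ[X]) (F : Type*) [Fintype F]

/-- The probability of a received packet: the generation is uniform, the coefficient vector is
uniform and independent of it. -/
noncomputable def packetProb (_p : Packet n g F) : ℝ :=
  (n : ℝ)⁻¹ * ((Fintype.card F : ℝ) ^ g)⁻¹

/-- The probability of a check equation: its degree is `d` with probability `P.coeff d`, given the
degree the set of its generations is uniform among the `d`-element sets, and all coefficients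
are uniform and independent. -/
noncomputable def checkProb (c : Check n g F) : ℝ :=
  P.coeff c.1.card / (n.choose c.1.card : ℝ) * (((Fintype.card F : ℝ) ^ g)⁻¹) ^ n

/-- The probability of an outcome. -/
noncomputable def sampleProb (ω : Sample n g m M F) : ℝ :=
  (∏ j, packetProb n g F (ω.1 j)) * ∏ c, checkProb n g P F (ω.2 c)

/-- The expectation of a random variable `X`. -/
noncomputable def expect (X : Sample n g m M F → ℝ) : ℝ :=
  ∑ ω, sampleProb n g m M P F ω * X ω

variable [Field F]

/-- The average fraction of full rank generations after iteration `i`. -/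
noncomputable def avgFullRank (i : ℕ) : ℝ :=
  expect n g m M P F fun ω => ((fullRank ω i).card : ℝ) / n

/-- The average of `y_i`. -/
noncomputable def avgNewDegreeOne (i : ℕ) : ℝ :=
  expect n g m M P F fun ω => (newDegreeOne ω i : ℝ)

/-- The average effective number of packets received from the outer code up to iteration `i`:
the `y_j` check equations used in iteration `j + 1`, all of which belong to generations that are not
of full rank, count as `y_j / (1 - x_j)` packets spread uniformly over all the generations, where
`x_j` is the average fraction of full rank generations after iteration `j`. -/
noncomputable def avgEffective (i : ℕ) : ℝ :=
  ∑ j ∈ Finset.range i, avgNewDegreeOne n g m M P F j / (1 - avgFullRank n g m M P F j)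

end Probability

end GammaCode

/-! The proof is a cavity argument with a second moment bound; no local tree limit of the random
hypergraph is needed. Received packets and check equations are treated alike, as independent random
items with a support and coefficient vectors. The decoder becomes a monotone peeling process
(`fullRank_toSample`), run more generally with a set `V` of frozen generations and a set `E` of
removed items. Peeling starts from the empty set, so iteration `i` of the decoder is round `i + 1`
of peeling.

Whether `v` is peeled in round `t + 1` can be read off from the process in which `v` is frozen
(`mem_peel_succ_iff_cavity`). There every item connected to `v` is inert (`peel_union_of_touch`), so
the items usable for `v` can be integrated out as if they were independent of the peeled set. If the
peeled fraction after `t` rounds concentrates at `x`, the `k`-th binomial moment of the number of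
usable items is asymptotically an elementary symmetric function of many small probabilities, and
tends to `s ^ k / k!` with `s = r + β P'(x)` (`prodExpect_mul_choose`,
`tendsto_sum_powersetCard_prod`). Inclusion-exclusion gives a Poisson law of mean `s`
(`tendsto_of_binomial_moments`). Over a large field, `g` or more usable items almost surely span
(`prodExpect_deficient_le`), so `v` is peeled with limiting probability `poissonTail g s`.

Concentration is carried to round `t + 1` by the second moment. The argument above also works
jointly with the peeled density of the process frozen at `v`, which shows that the mean of the
squared density tends to the square of the limit (`tendsto_avg_density_sq`, `concentrated`).

For the effective packets, a check of residual degree at least two has no influence, so the event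
that `c` drops to degree one in a given round may be tested in the process without `c`
(`newly_degree_one_iff`), which is independent of `c`. Its probability is asymptotically `(1 - x')
(P'(x') - P'(x)) / n` for each of the `n - |peeled|` possible survivors taken together after
multiplication by `n`, that is, `(1 - x') (P'(x') - P'(x))` in total. Division by `1 - x'` leaves a
telescoping sum (`tendsto_avgEffective`). -/

namespace GammaCode

/-! ### Deterministic peeling with frozen generations and removed items -/

section Peeling

variable {n g : ℕ} {F : Type*} [Field F] {ι : Type*} [Fintype ι] [DecidableEq ι]

/-- The items outside `E` whose support is `v` together with elements of `A`. -/
def usable (S : ι → Finset (Fin n)) (E : Finset ι) (A : Finset (Fin n)) (v : Fin n) : Finset ι :=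
  Finset.univ.filter fun e => e ∉ E ∧ v ∈ S e ∧ S e \ {v} ⊆ A

open Classical in
/-- The peeling process of the items outside `E`, in which the generations of `V` are never
declared to be of full rank. -/
noncomputable def peel (S : ι → Finset (Fin n)) (α : ι → Fin n → Fin g → F)
    (V : Finset (Fin n)) (E : Finset ι) : ℕ → Finset (Fin n)
  | 0 => ∅
  | t + 1 => Finset.univ.filter fun v => v ∉ V ∧
      Submodule.span F ((fun e => α e v) '' (usable S E (peel S α V E t) v : Set ι)) = ⊤

variable {S : ι → Finset (Fin n)} {α : ι → Fin n → Fin g → F}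
  {V V' U : Finset (Fin n)} {E E' : Finset ι} {v : Fin n}

lemma mem_usable {A : Finset (Fin n)} {e : ι} :
    e ∈ usable S E A v ↔ e ∉ E ∧ v ∈ S e ∧ S e \ {v} ⊆ A := by
  simp [usable]

lemma mem_peel_succ {t : ℕ} :
    v ∈ peel S α V E (t + 1) ↔ v ∉ V ∧
      Submodule.span F ((fun e => α e v) '' (usable S E (peel S α V E t) v : Set ι)) = ⊤ := by
  simp [peel]

lemma usable_subset {A A' : Finset (Fin n)} (hA : A ⊆ A') (hE : E' ⊆ E) :
    usable S E A v ⊆ usable S E' A' v := by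
  intro e he
  rw [mem_usable] at he ⊢
  exact ⟨fun h => he.1 (hE h), he.2.1, he.2.2.trans hA⟩

lemma span_usable_mono {A A' : Finset (Fin n)} (hA : A ⊆ A') (hE : E' ⊆ E)
    (h : Submodule.span F ((fun e => α e v) '' (usable S E A v : Set ι)) = ⊤) :
    Submodule.span F ((fun e => α e v) '' (usable S E' A' v : Set ι)) = ⊤ := by
  rw [eq_top_iff] at h ⊢
  exact h.trans (Submodule.span_mono (Set.image_mono (by exact_mod_cast usable_subset hA hE)))

lemma peel_subset (hV : V ⊆ V') (hE : E ⊆ E') (t : ℕ) : peel S α V' E' t ⊆ peel S α V E t := by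
  induction t with
  | zero => simp [peel]
  | succ t ih =>
    intro v hv
    rw [mem_peel_succ] at hv ⊢
    exact ⟨fun h => hv.1 (hV h), span_usable_mono ih hE hv.2⟩

lemma peel_subset_succ (t : ℕ) : peel S α V E t ⊆ peel S α V E (t + 1) := by
  induction t with
  | zero => simp [peel]
  | succ t ih =>
    intro v hv
    rw [mem_peel_succ] at hv ⊢
    exact ⟨hv.1, span_usable_mono ih subset_rfl hv.2⟩

lemma peel_mono : Monotone (peel S α V E) := monotone_nat_of_le_succ peel_subset_succ

lemma notMem_peel (hv : v ∈ V) (t : ℕ) : v ∉ peel S α V E t := by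
  cases t with
  | zero => simp [peel]
  | succ t => rw [mem_peel_succ]; tauto

/-- Items that meet the frozen set are inert. -/
lemma peel_union_of_touch (h : ∀ e ∈ E', ∃ u ∈ U, u ∈ S e) (t : ℕ) :
    peel S α U (E ∪ E') t = peel S α U E t := by
  induction t with
  | zero => rfl
  | succ t ih =>
    ext v
    rw [mem_peel_succ, mem_peel_succ, ih]
    refine and_congr_right fun hv => ?_
    have : usable S (E ∪ E') (peel S α U E t) v = usable S E (peel S α U E t) v := by
      ext e
      simp only [mem_usable, Finset.mem_union, not_or]
      refine ⟨fun h => ⟨h.1.1, h.2⟩, fun h' => ⟨⟨h'.1, fun he => ?_⟩, h'.2⟩⟩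
      -- A removed item usable for `v` would need its frozen generation `u ≠ v` to be peeled.
      obtain ⟨u, hu, hue⟩ := h e he
      have huv : u ≠ v := fun huv => hv (huv ▸ hu)
      exact notMem_peel hu t (h'.2.2 (by simp [hue, huv]))
    rw [this]

lemma usable_congr {S' : ι → Finset (Fin n)} (hS : ∀ e, e ∉ E → S e = S' e)
    (A : Finset (Fin n)) : usable S E A v = usable S' E A v := by
  ext e
  simp only [mem_usable]
  refine and_congr_right fun he => ?_
  rw [hS e he]

lemma peel_congr {S' : ι → Finset (Fin n)} {α' : ι → Fin n → Fin g → F}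
    (hS : ∀ e, e ∉ E → S e = S' e) (hα : ∀ e, e ∉ E → α e = α' e) (t : ℕ) :
    peel S α V E t = peel S' α' V E t := by
  induction t with
  | zero => rfl
  | succ t ih =>
    ext v
    rw [mem_peel_succ, mem_peel_succ, ih, usable_congr hS]
    have : (fun e => α e v) '' (usable S' E (peel S' α' V E t) v : Set ι)
        = (fun e => α' e v) '' (usable S' E (peel S' α' V E t) v : Set ι) := by
      refine Set.image_congr fun e he => ?_
      rw [hα e (mem_usable.1 (by exact_mod_cast he)).1]
    rw [this]

/-- Freezing `v` has an effect only from the round in which `v` would be peeled; before that both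
processes take the same decisions. -/
lemma peel_insert_eq {t : ℕ} (h : v ∉ peel S α V E t) {j : ℕ} (hj : j ≤ t) :
    peel S α (insert v V) E j = peel S α V E j := by
  induction j with
  | zero => rfl
  | succ j ih =>
    ext u
    rw [mem_peel_succ, mem_peel_succ, ih (by omega), Finset.mem_insert, not_or]
    constructor
    · exact fun hu => ⟨hu.1.2, hu.2⟩
    · refine fun hu => ⟨⟨?_, hu.1⟩, hu.2⟩
      rintro rfl
      exact h (peel_mono hj (mem_peel_succ.2 hu))

/-- Whether `v` is of full rank can be read off from the process in which `v` is frozen. -/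
lemma mem_peel_succ_iff_cavity (hv : v ∉ V) {t : ℕ} :
    v ∈ peel S α V E (t + 1) ↔
      Submodule.span F
        ((fun e => α e v) '' (usable S E (peel S α (insert v V) E t) v : Set ι)) = ⊤ := by
  constructor
  · intro h
    -- Let `s + 1` be the round in which `v` is peeled. Up to round `s` the cavity process is the
    -- original one, and later rounds only enlarge the set of usable items.
    obtain ⟨s, hst, hs, hs'⟩ : ∃ s ≤ t, v ∉ peel S α V E s ∧ v ∈ peel S α V E (s + 1) := by
      by_contra! hcon
      have : ∀ j ≤ t + 1, v ∉ peel S α V E j := by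
        intro j
        induction j with
        | zero => simp [peel]
        | succ j ih => exact fun hj => hcon j (by omega) (ih (by omega))
      exact this _ le_rfl h
    have h1 := (mem_peel_succ.1 hs').2
    rw [← peel_insert_eq hs le_rfl] at h1
    exact span_usable_mono (peel_mono hst) subset_rfl h1
  · intro h
    rw [mem_peel_succ]
    exact ⟨hv, span_usable_mono (peel_subset (Finset.subset_insert _ _) subset_rfl t) subset_rfl h⟩

omit [Fintype ι] [DecidableEq ι] in
lemma le_card_of_span_eq_top {s : Finset ι} {f : ι → Fin g → F}
    (h : Submodule.span F (f '' (s : Set ι)) = ⊤) : g ≤ s.card := by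
  classical
  have h1 : Module.finrank F (Submodule.span F ((s.image f : Finset _) : Set (Fin g → F)))
      ≤ (s.image f).card := finrank_span_finset_le_card _
  rw [Finset.coe_image, h, finrank_top, Module.finrank_fin_fun] at h1
  exact h1.trans Finset.card_image_le

omit [Fintype ι] in
/-- At least `g` vectors that do not span contain `g` vectors one of which is in the span of the
others. -/
lemma exists_mem_span_of_span_ne_top {s : Finset ι} {f : ι → Fin g → F} (hs : g ≤ s.card)
    (h : Submodule.span F (f '' (s : Set ι)) ≠ ⊤) :
    ∃ T ⊆ s, T.card = g ∧ ∃ e ∈ T, f e ∈ Submodule.span F (f '' ((T.erase e : Finset ι) : Set ι)) := by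
  obtain ⟨T, hT, hTc⟩ := Finset.exists_subset_card_eq hs
  refine ⟨T, hT, hTc, ?_⟩
  -- Otherwise the vectors of `T` would be `g` independent vectors in dimension `g`, and would span.
  by_contra! hcon
  apply h
  have hli : LinearIndependent F (fun e : T => f e) := by
    rw [linearIndependent_iff_notMem_span]
    intro e he
    refine hcon e e.2 ?_
    refine Submodule.span_mono ?_ he
    rintro _ ⟨a, ha, rfl⟩
    refine ⟨a, ?_, rfl⟩
    exact Finset.mem_coe.2 (Finset.mem_erase.2 ⟨fun h => ha.2 (Subtype.ext h), a.2⟩)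
  have htop := hli.span_eq_top_of_card_eq_finrank' (by simp [hTc])
  rw [eq_top_iff, ← htop]
  refine Submodule.span_mono ?_
  rintro _ ⟨e, rfl⟩
  exact ⟨e, by exact_mod_cast hT e.2, rfl⟩

/-- An item of residual degree at least two after `i` rounds is inert up to round `i + 1`. -/
lemma peel_singleton_eq {c : ι} {i : ℕ} (h : 2 ≤ (S c \ peel S α V {c} i).card) {j : ℕ}
    (hj : j ≤ i + 1) : peel S α V {c} j = peel S α V ∅ j := by
  induction j with
  | zero => rfl
  | succ j ih =>
    ext u
    rw [mem_peel_succ, mem_peel_succ, ← ih (by omega)]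
    have : usable S {c} (peel S α V {c} j) u = usable S ∅ (peel S α V {c} j) u := by
      ext e
      simp only [mem_usable, Finset.mem_singleton, Finset.notMem_empty, not_false_eq_true, true_and,
        and_iff_right_iff_imp]
      rintro ⟨h1, h2⟩ rfl
      -- If `c` were usable, at most `u` would remain of its support, against residual degree at
      -- least two.
      have : S e \ peel S α V {e} i ⊆ {u} := by
        intro x hx
        rw [Finset.mem_sdiff] at hx
        by_contra hxu
        exact hx.2 (peel_mono (by omega : j ≤ i) (h2 (Finset.mem_sdiff.2 ⟨hx.1, hxu⟩)))
      have := Finset.card_le_card this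
      simp at this
      omega
    rw [this]

/-- The item `c` is reduced to degree one by round `i + 1` and not earlier if and only if this holds
in the process without `c`. -/
lemma newly_degree_one_iff {c : ι} (hc : 2 ≤ (S c).card) (i : ℕ) :
    ((S c \ peel S α V ∅ (i + 1)).card = 1 ∧ ∀ j < i, (S c \ peel S α V ∅ (j + 1)).card ≠ 1) ↔
      ((S c \ peel S α V {c} (i + 1)).card = 1 ∧ (S c \ peel S α V {c} i).card ≠ 1) := by
  have hmono : ∀ E : Finset ι, ∀ j k : ℕ, j ≤ k →
      (S c \ peel S α V E k).card ≤ (S c \ peel S α V E j).card := fun E j k hjk =>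
    Finset.card_le_card (Finset.sdiff_subset_sdiff subset_rfl (peel_mono hjk))
  constructor
  · rintro ⟨h1, h2⟩
    -- The residual degree is nonincreasing and still positive in round `i + 1`, so not being one
    -- means being at least two. For `i = 0` nothing has been deleted and the bound is `hc`.
    have h3 : 2 ≤ (S c \ peel S α V ∅ i).card := by
      have := hmono ∅ i (i + 1) (by omega)
      cases i with
      | zero => simpa [peel] using hc
      | succ i => have := h2 i (by omega); omega
    -- Removing `c` shrinks the peeled sets, so the residual degree can only grow.
    have h4 : 2 ≤ (S c \ peel S α V {c} i).card := h3.trans (Finset.card_le_card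
      (Finset.sdiff_subset_sdiff subset_rfl (peel_subset subset_rfl (by simp) i)))
    rw [peel_singleton_eq h4 le_rfl]
    exact ⟨h1, by omega⟩
  · rintro ⟨h1, h2⟩
    have h4 : 2 ≤ (S c \ peel S α V {c} i).card := by
      have := hmono {c} i (i + 1) (by omega)
      omega
    rw [peel_singleton_eq h4 le_rfl] at h1
    refine ⟨h1, fun j hj => ?_⟩
    rw [← peel_singleton_eq h4 (by omega : j + 1 ≤ i + 1)]
    have := hmono {c} (j + 1) i (by omega)
    omega

end Peeling

/-! ### Expectations under finite product weights -/

section ProductExpectation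

variable {ι : Type*} [Fintype ι] [DecidableEq ι] {Y : ι → Type*} [∀ e, Fintype (Y e)]

/-- The expectation of `X` under the product of the weights `w e`. -/
noncomputable def prodExpect (w : ∀ e, Y e → ℝ) (X : (∀ e, Y e) → ℝ) : ℝ :=
  ∑ ω, (∏ e, w e (ω e)) * X ω

variable {w : ∀ e, Y e → ℝ}

lemma prodExpect_add (X X' : (∀ e, Y e) → ℝ) :
    prodExpect w (fun ω => X ω + X' ω) = prodExpect w X + prodExpect w X' := by
  simp [prodExpect, mul_add, Finset.sum_add_distrib]

lemma prodExpect_sub (X X' : (∀ e, Y e) → ℝ) :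
    prodExpect w (fun ω => X ω - X' ω) = prodExpect w X - prodExpect w X' := by
  simp [prodExpect, mul_sub, Finset.sum_sub_distrib]

lemma prodExpect_mul_left (a : ℝ) (X : (∀ e, Y e) → ℝ) :
    prodExpect w (fun ω => a * X ω) = a * prodExpect w X := by
  simp only [prodExpect, Finset.mul_sum]
  exact Finset.sum_congr rfl fun _ _ => by ring

lemma prodExpect_div (X : (∀ e, Y e) → ℝ) (a : ℝ) :
    prodExpect w (fun ω => X ω / a) = prodExpect w X / a := by
  simp only [div_eq_inv_mul, prodExpect_mul_left]

lemma prodExpect_sum {β : Type*} (s : Finset β) (X : β → (∀ e, Y e) → ℝ) :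
    prodExpect w (fun ω => ∑ b ∈ s, X b ω) = ∑ b ∈ s, prodExpect w (X b) := by
  simp only [prodExpect, Finset.mul_sum]
  exact Finset.sum_comm

lemma prodExpect_const (hw : ∀ e, ∑ y, w e y = 1) (a : ℝ) :
    prodExpect w (fun _ => a) = a := by
  simp only [prodExpect, ← Finset.sum_mul]
  rw [← Fintype.prod_sum]
  simp [hw]

lemma prodExpect_mono (hw0 : ∀ e y, 0 ≤ w e y) {X X' : (∀ e, Y e) → ℝ} (h : ∀ ω, X ω ≤ X' ω) :
    prodExpect w X ≤ prodExpect w X' :=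
  Finset.sum_le_sum fun ω _ => mul_le_mul_of_nonneg_left (h ω)
    (Finset.prod_nonneg fun e _ => hw0 e _)

lemma prodExpect_nonneg (hw0 : ∀ e y, 0 ≤ w e y) {X : (∀ e, Y e) → ℝ} (h : ∀ ω, 0 ≤ X ω) :
    0 ≤ prodExpect w X :=
  Finset.sum_nonneg fun ω _ => mul_nonneg (Finset.prod_nonneg fun e _ => hw0 e _) (h ω)

lemma prodExpect_le (hw0 : ∀ e y, 0 ≤ w e y) (hw : ∀ e, ∑ y, w e y = 1) {X : (∀ e, Y e) → ℝ}
    {a : ℝ} (h : ∀ ω, X ω ≤ a) : prodExpect w X ≤ a :=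
  (prodExpect_mono hw0 h).trans (prodExpect_const hw a).le

lemma abs_prodExpect_le (hw0 : ∀ e y, 0 ≤ w e y) (X : (∀ e, Y e) → ℝ) :
    |prodExpect w X| ≤ prodExpect w (fun ω => |X ω|) := by
  refine (Finset.abs_sum_le_sum_abs _ _).trans (le_of_eq (Finset.sum_congr rfl fun ω _ => ?_))
  rw [abs_mul, abs_of_nonneg (Finset.prod_nonneg fun e _ => hw0 e _)]

/-- Nonnegativity of the variance. -/
lemma prodExpect_sq_le (hw0 : ∀ e y, 0 ≤ w e y) (hw : ∀ e, ∑ y, w e y = 1)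
    (X : (∀ e, Y e) → ℝ) : prodExpect w X ^ 2 ≤ prodExpect w (fun ω => X ω ^ 2) := by
  set a := prodExpect w X
  have h : 0 ≤ prodExpect w (fun ω => (X ω ^ 2 - 2 * a * X ω) + a ^ 2) :=
    prodExpect_nonneg hw0 fun ω => by nlinarith [sq_nonneg (X ω - a)]
  rw [prodExpect_add, prodExpect_sub, prodExpect_mul_left, prodExpect_const hw] at h
  change 0 ≤ _ - 2 * a * a + a ^ 2 at h
  linarith

/-- Resampling one coordinate does not change the expectation. -/
lemma prodExpect_resample (hw : ∀ e, ∑ y, w e y = 1) (e : ι) (X : (∀ e, Y e) → ℝ) :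
    prodExpect w X = prodExpect w (fun ω => ∑ y, w e y * X (Function.update ω e y)) := by
  classical
  -- Fubini with coordinate `e` split off. After resampling, the old value of this coordinate occurs
  -- only in its weight, which sums to one.
  have key : ∀ X : (∀ e, Y e) → ℝ, prodExpect w X =
      ∑ r : (∀ j : {j // j ≠ e}, Y j), ∑ y : Y e,
        w e y * (∏ j : {j // j ≠ e}, w j (r j)) * X ((Equiv.piSplitAt e Y).symm (y, r)) := by
    intro X
    rw [prodExpect, ← (Equiv.piSplitAt e Y).symm.sum_comp, Fintype.sum_prod_type_right]
    refine Finset.sum_congr rfl fun r _ => Finset.sum_congr rfl fun y _ => ?_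
    congr 1
    rw [Fintype.prod_eq_mul_prod_subtype_ne _ e]
    congr 1
    · simp [Equiv.piSplitAt]
    · refine Finset.prod_congr rfl fun j _ => ?_
      simp [Equiv.piSplitAt, j.2]
  rw [key, key]
  refine Finset.sum_congr rfl fun r _ => ?_
  have hupd : ∀ y y', Function.update ((Equiv.piSplitAt e Y).symm (y, r)) e y'
      = (Equiv.piSplitAt e Y).symm (y', r) := by
    intro y y'
    ext j
    by_cases hj : j = e
    · subst hj; simp [Equiv.piSplitAt]
    · simp [Equiv.piSplitAt, hj]
  simp only [hupd]
  rw [← Finset.sum_mul, ← Finset.sum_mul, hw, one_mul, Finset.mul_sum]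
  exact Finset.sum_congr rfl fun y _ => by ring

/-- Integrating out several coordinates which enter in product form. -/
lemma prodExpect_prod (hw : ∀ e, ∑ y, w e y = 1) (s : Finset ι)
    (f : ∀ e, (∀ e, Y e) → Y e → ℝ) (G : (∀ e, Y e) → ℝ)
    (hf : ∀ e ∈ s, ∀ e' ∈ s, ∀ ω y, f e (Function.update ω e' y) = f e ω)
    (hG : ∀ e' ∈ s, ∀ ω y, G (Function.update ω e' y) = G ω) :
    prodExpect w (fun ω => (∏ e ∈ s, f e ω (ω e)) * G ω) =
      prodExpect w (fun ω => (∏ e ∈ s, ∑ y, w e y * f e ω y) * G ω) := by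
  induction s using Finset.induction_on generalizing G with
  | empty => rfl
  | insert a s ha ih =>
    have h1 : prodExpect w (fun ω => (∏ e ∈ insert a s, f e ω (ω e)) * G ω) =
        prodExpect w (fun ω => (∏ e ∈ s, f e ω (ω e)) * (f a ω (ω a) * G ω)) := by
      congr 1; ext ω; rw [Finset.prod_insert ha]; ring
    -- The factor of `a` is absorbed into `G`, which is allowed because it does not depend on the
    -- coordinates in `s`; coordinate `a` itself is integrated out last.
    rw [h1, ih (fun ω => f a ω (ω a) * G ω)
      (fun e he e' he' => hf e (Finset.mem_insert_of_mem he) e' (Finset.mem_insert_of_mem he'))]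
    · rw [prodExpect_resample hw a]
      congr 1; ext ω
      rw [Finset.prod_insert ha]
      have h2 : ∀ y, (∏ e ∈ s, ∑ y', w e y' * f e (Function.update ω a y) y')
          = ∏ e ∈ s, ∑ y', w e y' * f e ω y' := fun y =>
        Finset.prod_congr rfl fun e he => by
          rw [hf e (Finset.mem_insert_of_mem he) a (Finset.mem_insert_self _ _)]
      simp only [h2, hf a (Finset.mem_insert_self _ _) a (Finset.mem_insert_self _ _),
        hG a (Finset.mem_insert_self _ _), Function.update_self]
      rw [Finset.sum_mul, Finset.sum_mul]
      exact Finset.sum_congr rfl fun y _ => by ring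
    · intro e' he' ω y
      have hne : a ≠ e' := fun h => ha (h ▸ he')
      rw [hf a (Finset.mem_insert_self _ _) e' (Finset.mem_insert_of_mem he'),
        hG e' (Finset.mem_insert_of_mem he'), Function.update_of_ne hne]

end ProductExpectation

/-! ### Binomial moments of usable items, and failure to span -/

section RandomPeeling

variable {n g : ℕ} {F : Type*} [Field F] {ι : Type*} [Fintype ι] [DecidableEq ι] {Y : ι → Type*}
  (supp : ∀ e, Y e → Finset (Fin n)) (vec : ∀ e, Y e → Fin n → Fin g → F)

/-- The peeling process of the outcome `ω`. -/
noncomputable def peelAt (ω : ∀ e, Y e) (V : Finset (Fin n)) (E : Finset ι) (t : ℕ) :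
    Finset (Fin n) :=
  peel (fun e => supp e (ω e)) (fun e => vec e (ω e)) V E t

/-- The items which are usable for `v` with respect to the `t`-th peeled set. -/
noncomputable def usableAt (ω : ∀ e, Y e) (V : Finset (Fin n)) (E : Finset ι) (t : ℕ)
    (v : Fin n) : Finset ι :=
  usable (fun e => supp e (ω e)) E (peelAt supp vec ω V E t) v

variable {supp vec}

/-- Independence of the process from its removed items: their values are never consulted. -/
lemma peelAt_update {E : Finset ι} {e : ι} (he : e ∈ E) (ω : ∀ e, Y e) (y : Y e)
    (V : Finset (Fin n)) (t : ℕ) :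
    peelAt supp vec (Function.update ω e y) V E t = peelAt supp vec ω V E t := by
  refine peel_congr (fun e' he' => ?_) (fun e' he' => ?_) t
  all_goals
    have : e' ≠ e := fun h => he' (h ▸ he)
    simp [Function.update_of_ne this]

/-- The binomial coefficient counts the `k`-sets of usable items, so a binomial moment becomes a sum
of products of one-item indicators. -/
lemma card_usable_choose {S : ι → Finset (Fin n)} {E : Finset ι} {A : Finset (Fin n)} {v : Fin n}
    (k : ℕ) : (((usable S E A v).card.choose k : ℕ) : ℝ) =
      ∑ E' ∈ Finset.powersetCard k (Finset.univ \ E),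
        ∏ e ∈ E', if v ∈ S e ∧ S e \ {v} ⊆ A then (1 : ℝ) else 0 := by
  simp only [Finset.prod_ite_zero, Finset.prod_const_one]
  rw [Finset.sum_boole, ← Finset.card_powersetCard]
  congr 2
  ext E'
  simp only [Finset.mem_powersetCard, Finset.mem_filter, Finset.subset_iff, mem_usable,
    Finset.mem_sdiff, Finset.mem_univ, true_and]
  constructor
  · rintro ⟨h, hk⟩
    exact ⟨⟨fun e he => (h he).1, hk⟩, fun e he => (h he).2⟩
  · rintro ⟨⟨h, hk⟩, h'⟩
    exact ⟨fun e he => ⟨h he, h' e he⟩, hk⟩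

variable [∀ e, Fintype (Y e)] {w : ∀ e, Y e → ℝ}

/-- The binomial moments of the number of usable items of a frozen generation. -/
lemma prodExpect_mul_choose (hw : ∀ e, ∑ y, w e y = 1) {π : ι → ℕ → ℝ}
    (hπ : ∀ e (A : Finset (Fin n)) v, v ∉ A →
      ∑ y, w e y * (if v ∈ supp e y ∧ supp e y \ {v} ⊆ A then 1 else 0) = π e A.card)
    {U : Finset (Fin n)} {v : Fin n} (hv : v ∈ U) (E : Finset ι)
    (ψ : Finset ι → (∀ e, Y e) → ℝ)
    (hψ : ∀ E', ∀ ω : ∀ e, Y e, (∀ e ∈ E', v ∈ supp e (ω e)) → ψ (E ∪ E') ω = ψ E ω)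
    (hψ' : ∀ E', ∀ e ∈ E', ∀ (ω : ∀ e, Y e) (y : Y e), ψ E' (Function.update ω e y) = ψ E' ω)
    (k t : ℕ) :
    prodExpect w (fun ω => ψ E ω * ((usableAt supp vec ω U E t v).card.choose k : ℕ)) =
      ∑ E' ∈ Finset.powersetCard k (Finset.univ \ E),
        prodExpect w (fun ω =>
          (∏ e ∈ E', π e (peelAt supp vec ω U (E ∪ E') t).card) * ψ (E ∪ E') ω) := by
  simp only [usableAt, card_usable_choose, Finset.mul_sum]
  rw [prodExpect_sum]
  refine Finset.sum_congr rfl fun E' _ => ?_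
  have h1 : prodExpect w (fun ω => ψ E ω * ∏ e ∈ E',
        if v ∈ supp e (ω e) ∧ supp e (ω e) \ {v} ⊆ peelAt supp vec ω U E t then (1 : ℝ) else 0) =
      prodExpect w (fun ω => (∏ e ∈ E', if v ∈ supp e (ω e) ∧
        supp e (ω e) \ {v} ⊆ peelAt supp vec ω U (E ∪ E') t then (1 : ℝ) else 0)
          * ψ (E ∪ E') ω) := by
    congr 1; ext ω
    -- If all items of `E'` touch the frozen `v` they are inert, and removing them changes neither
    -- the peeled set nor `ψ`. If one does not, both products vanish.
    by_cases h : ∀ e ∈ E', v ∈ supp e (ω e)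
    · have h2 : peelAt supp vec ω U (E ∪ E') t = peelAt supp vec ω U E t :=
        peel_union_of_touch (fun e he => ⟨v, hv, h e he⟩) t
      rw [hψ E' ω h, h2, mul_comm]
    · push Not at h
      obtain ⟨e, he, hve⟩ := h
      rw [Finset.prod_eq_zero he (by simp [hve]), Finset.prod_eq_zero he (by simp [hve])]
      ring
  -- The peeled set and `ψ` now ignore the items of `E'`, which can be averaged separately.
  rw [h1, prodExpect_prod hw E' (fun e ω y => if v ∈ supp e y ∧
        supp e y \ {v} ⊆ peelAt supp vec ω U (E ∪ E') t then (1 : ℝ) else 0) (ψ (E ∪ E'))]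
  · congr 1; ext ω
    congr 1
    exact Finset.prod_congr rfl fun e _ => hπ e _ v (notMem_peel hv t)
  · intro e _ e' he' ω y
    ext y'
    rw [peelAt_update (Finset.mem_union_right _ he')]
  · intro e' he' ω y
    exact hψ' _ e' (Finset.mem_union_right _ he') ω y

/-- It is unlikely that at least `g` usable items do not span. -/
lemma prodExpect_deficient_le (hg : 1 ≤ g) (hw0 : ∀ e y, 0 ≤ w e y) (hw : ∀ e, ∑ y, w e y = 1)
    {δ ε : ℝ} (hε : 0 ≤ ε) {v : Fin n}
    (hsupp : ∀ e, ∑ y, w e y * (if v ∈ supp e y then 1 else 0) ≤ δ)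
    (hvec : ∀ e (H : Submodule F (Fin g → F)), H ≠ ⊤ →
      ∑ y, w e y * (open Classical in if v ∈ supp e y ∧ vec e y v ∈ H then 1 else 0) ≤ ε)
    (U : Finset (Fin n)) (E : Finset ι) (t : ℕ) :
    prodExpect w (fun ω => open Classical in
      if g ≤ (usableAt supp vec ω U E t v).card ∧
        Submodule.span F ((fun e => vec e (ω e) v) '' (usableAt supp vec ω U E t v : Set ι)) ≠ ⊤
      then 1 else 0) ≤ (Fintype.card ι).choose g * (g * (δ ^ (g - 1) * ε)) := by
  classical
  -- Union bound over the `g`-sets `T` of items at `v` and an element of `T` whose vector depends on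
  -- the others.
  have hle : ∀ ω : ∀ e, Y e, (if g ≤ (usableAt supp vec ω U E t v).card ∧
        Submodule.span F ((fun e => vec e (ω e) v) '' (usableAt supp vec ω U E t v : Set ι)) ≠ ⊤
      then (1 : ℝ) else 0) ≤ ∑ T ∈ Finset.powersetCard g (Finset.univ : Finset ι), ∑ e ∈ T,
        ((∏ e' ∈ T.erase e, if v ∈ supp e' (ω e') then (1 : ℝ) else 0) *
          if v ∈ supp e (ω e) ∧ vec e (ω e) v ∈ (Submodule.span F
            ((fun e => vec e (ω e) v) '' ((T.erase e : Finset ι) : Set ι)))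
          then 1 else 0) := by
    intro ω
    have hnn : ∀ T : Finset ι, ∀ e, (0 : ℝ) ≤ (∏ e' ∈ T.erase e,
        if v ∈ supp e' (ω e') then (1 : ℝ) else 0) *
          if v ∈ supp e (ω e) ∧ vec e (ω e) v ∈ (Submodule.span F
            ((fun e => vec e (ω e) v) '' ((T.erase e : Finset ι) : Set ι)))
          then 1 else 0 := fun T e =>
      mul_nonneg (Finset.prod_nonneg fun _ _ => by split_ifs <;> simp) (by split_ifs <;> simp)
    split_ifs with h
    · obtain ⟨T, hT, hTc, e, he, hmem⟩ := exists_mem_span_of_span_ne_top h.1 h.2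
      have hv : ∀ e ∈ T, v ∈ supp e (ω e) := fun e he => (mem_usable.1 (hT he)).2.1
      refine le_trans ?_ (Finset.single_le_sum (f := fun T : Finset ι => ∑ e ∈ T, _)
        (fun T _ => Finset.sum_nonneg fun e _ => hnn T e)
        (Finset.mem_powersetCard.2 ⟨Finset.subset_univ T, hTc⟩))
      refine le_trans ?_ (Finset.single_le_sum (fun e _ => hnn T e) he)
      rw [if_pos ⟨hv e he, hmem⟩, Finset.prod_eq_one, one_mul]
      exact fun e' he' => if_pos (hv e' (Finset.mem_of_mem_erase he'))
    · exact Finset.sum_nonneg fun T _ => Finset.sum_nonneg fun e _ => hnn T e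
  refine (prodExpect_mono hw0 hle).trans ?_
  rw [prodExpect_sum, ← nsmul_eq_mul, ← Finset.card_univ, ← Finset.card_powersetCard]
  refine Finset.sum_le_card_nsmul _ _ _ fun T hT => ?_
  have hTc := (Finset.mem_powersetCard.1 hT).2
  rw [prodExpect_sum, ← nsmul_eq_mul]
  refine (Finset.sum_le_card_nsmul _ _ (δ ^ (g - 1) * ε) fun e he => ?_).trans (by rw [hTc])
  rw [prodExpect_resample hw e]
  have hlin : ∀ ω : ∀ e, Y e, ∑ y, w e y *
      ((∏ e' ∈ T.erase e, if v ∈ supp e' (Function.update ω e y e') then (1 : ℝ) else 0) *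
          if v ∈ supp e (Function.update ω e y e) ∧
            vec e (Function.update ω e y e) v ∈ (Submodule.span F
            ((fun e' => vec e' (Function.update ω e y e') v) ''
              ((T.erase e : Finset ι) : Set ι)))
          then 1 else 0) ≤
      (∏ e' ∈ T.erase e, if v ∈ supp e' (ω e') then (1 : ℝ) else 0) * ε := by
    intro ω
    have h1 : ∀ y, (∏ e' ∈ T.erase e, if v ∈ supp e' (Function.update ω e y e') then (1 : ℝ) else 0)
        = ∏ e' ∈ T.erase e, if v ∈ supp e' (ω e') then (1 : ℝ) else 0 := fun y =>
      Finset.prod_congr rfl fun e' he' => by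
        rw [Function.update_of_ne (Finset.ne_of_mem_erase he')]
    have h2 : ∀ y, (fun e' => vec e' (Function.update ω e y e') v) ''
              ((T.erase e : Finset ι) : Set ι) = (fun e' => vec e' (ω e') v) ''
              ((T.erase e : Finset ι) : Set ι) := fun y =>
      Set.image_congr fun e' he' => by
        rw [Function.update_of_ne (Finset.ne_of_mem_erase (Finset.mem_coe.1 he'))]
    simp only [h1, h2, Function.update_self]
    -- The other `g - 1` vectors span a proper subspace, fixed before item `e` is drawn.
    have h3 := hvec e (Submodule.span F ((fun e' => vec e' (ω e') v) ''
              ((T.erase e : Finset ι) : Set ι))) (fun htop => by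
        have := le_card_of_span_eq_top htop
        rw [Finset.card_erase_of_mem he, hTc] at this
        omega)
    calc _ = (∏ e' ∈ T.erase e, if v ∈ supp e' (ω e') then (1 : ℝ) else 0) *
          ∑ y, w e y * (if v ∈ supp e y ∧ vec e y v ∈ (Submodule.span F ((fun e' => vec e' (ω e') v) ''
              ((T.erase e : Finset ι) : Set ι))) then 1 else 0) := by
          rw [Finset.mul_sum]
          exact Finset.sum_congr rfl fun y _ => by ring
      _ ≤ _ := by
          refine mul_le_mul_of_nonneg_left ?_
            (Finset.prod_nonneg fun _ _ => by split_ifs <;> simp)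
          convert h3
  refine (prodExpect_mono hw0 hlin).trans ?_
  rw [prodExpect_prod hw (T.erase e) (fun e' _ y => if v ∈ supp e' y then (1 : ℝ) else 0)
    (fun _ => ε) (fun _ _ _ _ _ _ => rfl) (fun _ _ _ _ => rfl)]
  refine prodExpect_le hw0 hw fun ω => ?_
  refine mul_le_mul_of_nonneg_right ?_ hε
  have hc : g - 1 = (T.erase e).card := by rw [Finset.card_erase_of_mem he, hTc]
  rw [hc, ← Finset.prod_const]
  refine Finset.prod_le_prod (fun e' _ => Finset.sum_nonneg fun y _ =>
    mul_nonneg (hw0 e' y) (by split_ifs <;> simp)) fun e' _ => hsupp e'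

end RandomPeeling

/-! ### Elementary symmetric functions and Poisson limits -/

section Analysis

/-- The elementary symmetric functions of many small nonnegative numbers of sum about `s`. -/
lemma tendsto_sum_powersetCard_prod {κ : Type*} {l : Filter κ} {ι : κ → Type*}
    [∀ c, Fintype (ι c)] [∀ c, DecidableEq (ι c)] (E : ∀ c, Finset (ι c)) (a : ∀ c, ι c → ℝ)
    (ha : ∀ c e, 0 ≤ a c e) {δ : κ → ℝ} (hδ : ∀ᶠ c in l, ∀ e, a c e ≤ δ c)
    (hδ0 : Tendsto δ l (𝓝 0)) {s : ℝ}
    (hs : Tendsto (fun c => ∑ e ∈ Finset.univ \ E c, a c e) l (𝓝 s)) (k : ℕ) :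
    Tendsto (fun c => ∑ T ∈ Finset.powersetCard k (Finset.univ \ E c), ∏ e ∈ T, a c e) l
      (𝓝 (s ^ k / k.factorial)) := by
  -- Setting the excluded entries to zero makes the sum a full elementary symmetric polynomial, to
  -- which Newton's identities apply.
  set a' : ∀ c, ι c → ℝ := fun c e => if e ∈ E c then 0 else a c e with ha'
  have ha'0 : ∀ c e, 0 ≤ a' c e := fun c e => by
    simp only [ha']; split_ifs <;> simp [ha]
  have ha'le : ∀ c e, a' c e ≤ a c e := fun c e => by
    simp only [ha']; split_ifs <;> simp [ha]
  set es : κ → ℕ → ℝ := fun c k => MvPolynomial.aeval (a' c) (MvPolynomial.esymm (ι c) ℝ k) with hes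
  have hes' : ∀ c k, ∑ T ∈ Finset.powersetCard k (Finset.univ \ E c), ∏ e ∈ T, a c e = es c k := by
    intro c k
    simp only [hes, MvPolynomial.esymm, map_sum, map_prod, MvPolynomial.aeval_X]
    rw [← Finset.sum_subset (Finset.powersetCard_mono (Finset.subset_univ (Finset.univ \ E c)))]
    · refine Finset.sum_congr rfl fun T hT => Finset.prod_congr rfl fun e he => ?_
      have := (Finset.mem_powersetCard.1 hT).1 he
      rw [Finset.mem_sdiff] at this
      simp [ha', this.2]
    · intro T hT hT'
      rw [Finset.mem_powersetCard] at hT hT'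
      obtain ⟨e, he, heE⟩ : ∃ e ∈ T, e ∈ E c := by
        by_contra! hcon
        exact hT' ⟨fun e he => by simp [hcon e he], hT.2⟩
      exact Finset.prod_eq_zero he (by simp [ha', heE])
  have hs' : Tendsto (fun c => ∑ e, a' c e) l (𝓝 s) := by
    refine hs.congr fun c => ?_
    rw [← Finset.sum_subset (Finset.subset_univ (Finset.univ \ E c))]
    · refine Finset.sum_congr rfl fun e he => ?_
      rw [Finset.mem_sdiff] at he
      simp [ha', he.2]
    · intro e _ he
      simp only [Finset.mem_sdiff, Finset.mem_univ, true_and, not_not] at he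
      simp [ha', he]
  -- Power sums of exponent at least two are at most `δ ^ (r + 1)` times the first one.
  have hps : ∀ r, Tendsto (fun c => ∑ e, a' c e ^ (r + 2)) l (𝓝 0) := by
    intro r
    have h1 : Tendsto (fun c => δ c ^ (r + 1) * ∑ e, a' c e) l (𝓝 0) := by
      simpa using (hδ0.pow (r + 1)).mul hs'
    refine squeeze_zero' (Eventually.of_forall fun c => Finset.sum_nonneg fun e _ =>
      pow_nonneg (ha'0 c e) _) (hδ.mono fun c hc => ?_) h1
    rw [Finset.mul_sum]
    refine Finset.sum_le_sum fun e _ => ?_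
    rw [pow_succ _ (r + 1)]
    exact mul_le_mul_of_nonneg_right (pow_le_pow_left₀ (ha'0 c e) ((ha'le c e).trans (hc e)) _)
      (ha'0 c e)
  simp only [hes']
  induction k using Nat.strong_induction_on with
  | _ k ih =>
    rcases k with _ | k
    · simp [hes, tendsto_const_nhds]
    · have hN : ∀ c, ((k + 1 : ℕ) : ℝ) * es c (k + 1) = (-1) ^ (k + 1 + 1) *
          ∑ x ∈ (Finset.HasAntidiagonal.antidiagonal (k + 1)).filter (fun x => x.1 ∈ Set.Iio (k + 1)),
            (-1) ^ x.1 * es c x.1 * ∑ e, a' c e ^ x.2 := by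
        intro c
        have := congrArg (MvPolynomial.aeval (a' c))
          (MvPolynomial.mul_esymm_eq_sum (ι c) ℝ (k + 1))
        simpa [MvPolynomial.psum, hes] using this
      -- In the limit of Newton's identity only the term with the first power sum survives, leaving
      -- the recursion `(k + 1) e_{k+1} = e_k s`.
      have hlim : Tendsto (fun c => ((k + 1 : ℕ) : ℝ) * es c (k + 1)) l
          (𝓝 ((-1) ^ (k + 1 + 1) *
            ∑ x ∈ (Finset.HasAntidiagonal.antidiagonal (k + 1)).filter (fun x => x.1 ∈ Set.Iio (k + 1)),
              if x = (k, 1) then (-1) ^ k * (s ^ k / k.factorial) * s else 0)) := by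
        simp only [hN]
        refine Tendsto.const_mul _ (tendsto_finsetSum _ fun x hx => ?_)
        rw [Finset.mem_filter, Finset.HasAntidiagonal.mem_antidiagonal, Set.mem_Iio] at hx
        have hx1 := (ih x.1 hx.2).const_mul ((-1) ^ x.1)
        split_ifs with h
        · rw [h] at hx1 ⊢
          simpa using hx1.mul hs'
        · obtain ⟨r, hr⟩ : ∃ r, x.2 = r + 2 := by
            refine ⟨x.2 - 2, ?_⟩
            have : x.2 ≠ 1 := fun h2 => h (Prod.ext (by simp; omega) h2)
            omega
          rw [hr]
          simpa using hx1.mul (hps r)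
      rw [Finset.sum_ite_eq', if_pos (by simp [Finset.HasAntidiagonal.mem_antidiagonal])] at hlim
      have hk : ((k + 1 : ℕ) : ℝ) ≠ 0 := by positivity
      have := hlim.const_mul (((k + 1 : ℕ) : ℝ)⁻¹)
      simp only [inv_mul_cancel_left₀ hk] at this
      convert this using 2
      have hsg : ((-1 : ℝ)) ^ (k + 1 + 1) * (-1) ^ k = 1 := by
        rw [← pow_add]; exact Even.neg_one_pow ⟨k + 1, by ring⟩
      have hf : (k.factorial : ℝ) ≠ 0 := by positivity
      calc s ^ (k + 1) / ((k + 1).factorial : ℝ)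
          = ((k + 1 : ℕ) : ℝ)⁻¹ * (1 * (s ^ k / k.factorial * s)) := by
            rw [Nat.factorial_succ]; push_cast; field_simp; ring
        _ = _ := by
            linear_combination (-(((k + 1 : ℕ) : ℝ)⁻¹ * (s ^ k / k.factorial * s))) * hsg

/-- Inclusion-exclusion, used to recover probabilities from binomial moments. Since `C(Z,k) C(k,j) =
C(Z,j) C(Z-j,k-j)`, the sum is `C(Z,j)` times an alternating row sum, which vanishes unless `Z = j`.
-/
lemma sum_neg_one_pow_choose_mul_choose (j Z L : ℕ) (hZ : Z ≤ L) :
    ∑ k ∈ Finset.range (L + 1), (-1 : ℝ) ^ (k + j) * k.choose j * Z.choose k =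
      if Z = j then 1 else 0 := by
  have h0 : ∑ k ∈ Finset.range (L + 1), (-1 : ℝ) ^ (k + j) * k.choose j * Z.choose k =
      ∑ k ∈ Finset.range (Z + 1), (-1 : ℝ) ^ (k + j) * k.choose j * Z.choose k := by
    symm
    refine Finset.sum_subset (by simpa using hZ) fun k _ hk => ?_
    rw [Nat.choose_eq_zero_of_lt (n := Z) (by simpa using hk)]
    simp
  rw [h0]
  rcases lt_or_ge Z j with h | h
  · rw [if_neg (by omega)]
    refine Finset.sum_eq_zero fun k hk => ?_
    rw [Nat.choose_eq_zero_of_lt (k := j) (by simp at hk; omega)]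
    simp
  · obtain ⟨r, rfl⟩ := Nat.exists_eq_add_of_le h
    rw [Finset.range_eq_Ico, ← Finset.sum_subset (s₁ := Finset.Ico j (j + r + 1))
      (Finset.Ico_subset_Ico (by omega) le_rfl), Finset.sum_Ico_eq_sum_range]
    · have : ∀ i ∈ Finset.range (j + r + 1 - j), (-1 : ℝ) ^ (j + i + j) * (j + i).choose j *
          (j + r).choose (j + i) = (j + r).choose j * ((-1) ^ i * r.choose i) := by
        intro i hi
        have hi' : i ≤ r := by simp at hi; omega
        have h1 := Nat.choose_mul (n := j + r) (k := j + i) (s := j) (by omega)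
        have h2 : (-1 : ℝ) ^ (j + i + j) = (-1) ^ i := by
          rw [show j + i + j = 2 * j + i by ring, pow_add, pow_mul]; simp
        rw [Nat.add_sub_cancel_left, Nat.add_sub_cancel_left] at h1
        have h3 : ((j + r).choose (j + i) : ℝ) * (j + i).choose j = (j + r).choose j * r.choose i := by
          exact_mod_cast h1
        rw [h2]
        linear_combination (-1) ^ i * h3
      rw [Finset.sum_congr rfl this, ← Finset.mul_sum, show j + r + 1 - j = r + 1 by omega]
      have h4 := Int.alternating_sum_range_choose (n := r)
      have h5 : ∑ i ∈ Finset.range (r + 1), (-1 : ℝ) ^ i * r.choose i = if r = 0 then 1 else 0 := by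
        exact_mod_cast h4
      rw [h5]
      rcases Nat.eq_zero_or_pos r with rfl | hr
      · simp
      · rw [if_neg (by omega), if_neg (by omega), mul_zero]
    · intro k _ hk
      rw [Nat.choose_eq_zero_of_lt (k := j) (by
        simp only [Finset.mem_Ico, not_and, not_lt] at hk
        by_contra hcon
        exact absurd (hk (by omega)) (by simp at *; omega))]
      simp

/-- As `C(k,j) / k! = 1 / (j! (k-j)!)`, shifting by `j` leaves the exponential series. It serves at
`B` for domination and at `-s` for the value of the limit. -/
lemma hasSum_choose_mul_pow_div_factorial (j : ℕ) (s : ℝ) :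
    HasSum (fun k : ℕ => (k.choose j : ℝ) * (s ^ k / k.factorial))
      (s ^ j / j.factorial * Real.exp s) := by
  have h1 : HasSum (fun i : ℕ => s ^ i / (i.factorial : ℝ)) (Real.exp s) := by
    rw [Real.exp_eq_exp_ℝ]
    exact NormedSpace.expSeries_div_hasSum_exp s
  have h2 := h1.mul_left (s ^ j / j.factorial)
  rw [← hasSum_nat_add_iff' j]
  rw [Finset.sum_eq_zero (fun k hk => by
    rw [Nat.choose_eq_zero_of_lt (by simpa using hk)]; simp), sub_zero]
  refine h2.congr_fun ?_ |> fun h => h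
  intro i
  have h3 : ((i + j).choose j : ℝ) * (j.factorial * i.factorial) = (i + j).factorial := by
    have := Nat.add_choose_mul_factorial_mul_factorial i j
    have h4 : ((i + j).choose j : ℝ) * i.factorial * j.factorial = (i + j).factorial := by
      exact_mod_cast this
    linarith
  have hi : (i.factorial : ℝ) ≠ 0 := by positivity
  have hj : (j.factorial : ℝ) ≠ 0 := by positivity
  have hij : ((i + j).factorial : ℝ) ≠ 0 := by positivity
  rw [← h3] at hij ⊢
  have hc : ((i + j).choose j : ℝ) ≠ 0 := left_ne_zero_of_mul hij
  field_simp
  ring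

/-- Convergence of the binomial moments to those of a Poisson law implies convergence of the
probabilities. -/
lemma tendsto_of_binomial_moments {κ : Type*} {l : Filter κ} {b : κ → ℕ → ℝ} {B y s : ℝ}
    (hB : ∀ᶠ c in l, ∀ k, |b c k| ≤ B ^ k / k.factorial)
    (hb : ∀ k, Tendsto (fun c => b c k) l (𝓝 (y * (s ^ k / k.factorial)))) (j : ℕ) :
    Tendsto (fun c => ∑' k, (-1 : ℝ) ^ (k + j) * k.choose j * b c k) l
      (𝓝 (y * (Real.exp (-s) * (s ^ j / j.factorial)))) := by
  have h1 := tendsto_tsum_of_dominated_convergence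
    (f := fun c k => (-1 : ℝ) ^ (k + j) * k.choose j * b c k)
    (hasSum_choose_mul_pow_div_factorial j B).summable
    (fun k => (hb k).const_mul ((-1 : ℝ) ^ (k + j) * k.choose j))
    (hB.mono fun c hc k => by
      rw [Real.norm_eq_abs, abs_mul, abs_mul, abs_pow, abs_neg, abs_one, one_pow, one_mul,
        Nat.abs_cast]
      exact mul_le_mul_of_nonneg_left (hc k) (Nat.cast_nonneg _))
  have h2 := (hasSum_choose_mul_pow_div_factorial j (-s)).mul_left (y * (-1) ^ j)
  have h3 : ∑' k : ℕ, (-1 : ℝ) ^ (k + j) * k.choose j * (y * (s ^ k / k.factorial)) =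
      y * (Real.exp (-s) * (s ^ j / j.factorial)) := by
    have h4 : ∀ k : ℕ, (-1 : ℝ) ^ (k + j) * k.choose j * (y * (s ^ k / k.factorial)) =
        y * (-1) ^ j * (k.choose j * ((-s) ^ k / k.factorial)) := by
      intro k
      rw [neg_pow s k, pow_add]; ring
    simp only [h4]
    rw [h2.tsum_eq, neg_pow s j]
    have h5 : ((-1 : ℝ)) ^ j * (-1) ^ j = 1 := by rw [← mul_pow]; simp
    linear_combination (y * (s ^ j / j.factorial) * Real.exp (-s)) * h5
  rwa [h3] at h1

end Analysis

/-! ### Usability probability of a single check -/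

section CheckDegrees

/-- The probability that a check equation is connected to a given generation and that its other
generations belong to a given set of size `a`. -/
noncomputable def usableProb (n : ℕ) (P : ℝ[X]) (a : ℕ) : ℝ :=
  ∑ j ∈ Finset.range P.natDegree, (a.choose j : ℝ) * (P.coeff (j + 1) / n.choose (j + 1))

lemma derivative_eval_eq_sum (P : ℝ[X]) (x : ℝ) :
    P.derivative.eval x = ∑ j ∈ Finset.range P.natDegree, P.coeff (j + 1) * (j + 1) * x ^ j := by
  rcases Nat.eq_zero_or_pos P.natDegree with h | h
  · rw [h, eq_C_of_natDegree_eq_zero h]; simp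
  · rw [eval_eq_sum_range' (natDegree_derivative_lt h.ne')]
    simp [coeff_derivative]

/-- This identity is the source of the derivative: multiplied by `n`, the weight of a set of size `j
+ 1` acquires the factor `j + 1` of `P'`. -/
lemma mul_div_choose_succ (n j : ℕ) (hj : j < n) :
    (n : ℝ) / n.choose (j + 1) = (j + 1) / (n - 1).choose j := by
  obtain ⟨n, rfl⟩ : ∃ m, n = m + 1 := ⟨n - 1, by omega⟩
  have h1 := Nat.add_one_mul_choose_eq n j
  have h2 : ((n + 1).choose (j + 1) : ℝ) ≠ 0 := by
    exact_mod_cast (Nat.choose_pos (by omega)).ne'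
  have h3 : (n.choose j : ℝ) ≠ 0 := by exact_mod_cast (Nat.choose_pos (by omega)).ne'
  rw [Nat.add_sub_cancel, div_eq_div_iff h2 h3]
  have h4 : ((n : ℝ) + 1) * n.choose j = (n + 1).choose (j + 1) * (j + 1) := by exact_mod_cast h1
  push_cast
  linarith

/-- Sampling `j` of the `n - 1` other generations without replacement is compared with independent
sampling, one draw at a time. -/
lemma abs_choose_div_choose_sub_pow_le {n a j : ℕ} (ha : a < n) (hj : j < n) :
    |(a.choose j : ℝ) / (n - 1).choose j - ((a : ℝ) / n) ^ j| ≤ j ^ 2 / (n - j) := by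
  have hn : (0 : ℝ) < n := by exact_mod_cast (by omega : 0 < n)
  have hz0 : (0 : ℝ) ≤ a / n := by positivity
  have hz1 : (a : ℝ) / n ≤ 1 := by
    rw [div_le_one hn]; exact_mod_cast ha.le
  induction j with
  | zero => simp
  | succ j ih =>
    have ih := ih (by omega)
    have hpos : (0 : ℝ) < n - 1 - j := by
      have : ((j + 1 + 1 : ℕ) : ℝ) ≤ n := by exact_mod_cast hj
      push_cast at this; linarith
    set r : ℝ := (a.choose j : ℝ) / (n - 1).choose j with hr
    have hr0 : 0 ≤ r := by positivity
    have hr1 : r ≤ 1 := by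
      rw [hr, div_le_one (by exact_mod_cast Nat.choose_pos (by omega))]
      exact_mod_cast Nat.choose_le_choose j (by omega)
    have hrec : (a.choose (j + 1) : ℝ) / (n - 1).choose (j + 1) = r * ((a - j) / (n - 1 - j)) := by
      have h1 : (a.choose (j + 1) : ℝ) * (j + 1) = a.choose j * (a - j) := by
        rcases lt_or_ge a j with h | h
        · rw [Nat.choose_eq_zero_of_lt h, Nat.choose_eq_zero_of_lt (by omega)]; simp
        · rw [← Nat.cast_sub h]; exact_mod_cast Nat.choose_succ_right_eq a j
      have h2 : ((n - 1).choose (j + 1) : ℝ) * (j + 1) = (n - 1).choose j * (n - 1 - j) := by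
        have : ((n - 1 - j : ℕ) : ℝ) = n - 1 - j := by
          rw [Nat.cast_sub (by omega), Nat.cast_sub (by omega)]; simp
        rw [← this]; exact_mod_cast Nat.choose_succ_right_eq (n - 1) j
      have h3 : ((n - 1).choose j : ℝ) ≠ 0 := by exact_mod_cast (Nat.choose_pos (by omega)).ne'
      have h4 : ((n - 1).choose (j + 1) : ℝ) ≠ 0 := by
        exact_mod_cast (Nat.choose_pos (by omega)).ne'
      have hj1 : (j : ℝ) + 1 ≠ 0 := by positivity
      rw [hr, div_mul_div_comm, ← h1, ← h2, mul_div_mul_right _ _ hj1]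
    -- Over the denominator `n - 1 - j` the numerator lies between `-j` and `1`. The induction then
    -- closes because `1 + j + j ^ 2 ≤ (j + 1) ^ 2`.
    have hq : |((a : ℝ) - j) / (n - 1 - j) - a / n| ≤ (1 + j) / (n - 1 - j) := by
      have : ((a : ℝ) - j) / (n - 1 - j) - a / n = (a / n * (1 + j) - j) / (n - 1 - j) := by
        field_simp; ring
      rw [this, abs_div, abs_of_pos hpos]
      refine div_le_div_of_nonneg_right ?_ hpos.le
      rw [abs_le]
      have hj0 : (0 : ℝ) ≤ j := Nat.cast_nonneg _
      constructor <;> nlinarith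
    rw [hrec, pow_succ]
    calc |r * (((a : ℝ) - j) / (n - 1 - j)) - (a / n) ^ j * (a / n)|
        = |r * ((a - j) / (n - 1 - j) - a / n) + (r - (a / n) ^ j) * (a / n)| := by ring_nf
      _ ≤ |r * ((a - j) / (n - 1 - j) - a / n)| + |(r - (a / n) ^ j) * (a / n)| := abs_add_le _ _
      _ ≤ 1 * ((1 + j) / (n - 1 - j)) + j ^ 2 / (n - j) * 1 := by
          rw [abs_mul, abs_mul, abs_of_nonneg hr0, abs_of_nonneg hz0]
          gcongr
          exact (abs_nonneg _).trans ih
      _ ≤ 1 * ((1 + j) / (n - 1 - j)) + j ^ 2 / (n - 1 - j) * 1 := by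
          gcongr; linarith
      _ = (1 + j + j ^ 2) / (n - 1 - j) := by ring
      _ ≤ _ := by
          push_cast
          rw [show (n : ℝ) - (j + 1) = n - 1 - j by ring]
          refine div_le_div_of_nonneg_right ?_ hpos.le
          have : (0 : ℝ) ≤ j := Nat.cast_nonneg _
          nlinarith

variable {P : ℝ[X]} (hP : ∀ d, 0 ≤ P.coeff d)
include hP

lemma derivative_eval_nonneg {x : ℝ} (hx : 0 ≤ x) : 0 ≤ P.derivative.eval x := by
  rw [derivative_eval_eq_sum]
  exact Finset.sum_nonneg fun j _ => mul_nonneg (mul_nonneg (hP _) (by positivity)) (by positivity)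

lemma usableProb_nonneg (n a : ℕ) : 0 ≤ usableProb n P a :=
  Finset.sum_nonneg fun j _ => mul_nonneg (by positivity) (div_nonneg (hP _) (by positivity))

omit hP in
lemma mul_usableProb_eq {n : ℕ} (hn : P.natDegree ≤ n) (a : ℕ) :
    n * usableProb n P a = ∑ j ∈ Finset.range P.natDegree,
      P.coeff (j + 1) * (j + 1) * ((a.choose j : ℝ) / (n - 1).choose j) := by
  rw [usableProb, Finset.mul_sum]
  refine Finset.sum_congr rfl fun j hj => ?_
  have := mul_div_choose_succ n j (by simp at hj; omega)
  calc _ = (n : ℝ) / n.choose (j + 1) * (a.choose j * P.coeff (j + 1)) := by ring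
    _ = _ := by rw [this]; ring

lemma mul_usableProb_le {n a : ℕ} (hn : P.natDegree ≤ n) (ha : a < n) :
    n * usableProb n P a ≤ P.derivative.eval 1 := by
  rw [mul_usableProb_eq hn, derivative_eval_eq_sum]
  refine Finset.sum_le_sum fun j hj => ?_
  refine mul_le_mul_of_nonneg_left ?_ (mul_nonneg (hP _) (by positivity))
  rw [one_pow]
  refine div_le_one_of_le₀ ?_ (by positivity)
  exact_mod_cast Nat.choose_le_choose j (by omega)

lemma abs_mul_usableProb_sub_le {n a : ℕ} (hn : P.natDegree < n) (ha : a < n) :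
    |n * usableProb n P a - P.derivative.eval ((a : ℝ) / n)| ≤
      P.derivative.eval 1 * (P.natDegree ^ 2 / (n - P.natDegree)) := by
  have hpos : (0 : ℝ) < n - P.natDegree := by
    have : (P.natDegree : ℝ) < n := by exact_mod_cast hn
    linarith
  rw [mul_usableProb_eq hn.le, derivative_eval_eq_sum, derivative_eval_eq_sum,
    ← Finset.sum_sub_distrib, Finset.sum_mul]
  refine (Finset.abs_sum_le_sum_abs _ _).trans (Finset.sum_le_sum fun j hj => ?_)
  have hc : 0 ≤ P.coeff (j + 1) * ((j : ℝ) + 1) := mul_nonneg (hP _) (by positivity)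
  have hj' : j < P.natDegree := by simpa using hj
  have hjr : (j : ℝ) ≤ P.natDegree := by exact_mod_cast hj'.le
  rw [← mul_sub, abs_mul, abs_of_nonneg hc, one_pow, mul_one]
  refine mul_le_mul_of_nonneg_left ?_ hc
  refine (abs_choose_div_choose_sub_pow_le ha (by omega)).trans ?_
  gcongr

/-- Mean value inequality: `P''` has nonnegative coefficients, so on the unit interval it is largest
at `1`. -/
lemma abs_derivative_eval_sub_le {x y : ℝ} (hx : x ∈ Set.Icc (0 : ℝ) 1)
    (hy : y ∈ Set.Icc (0 : ℝ) 1) :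
    |P.derivative.eval x - P.derivative.eval y| ≤
      P.derivative.derivative.eval 1 * |x - y| := by
  have hP' : ∀ d, 0 ≤ P.derivative.coeff d := fun d => by
    rw [coeff_derivative]; exact mul_nonneg (hP _) (by positivity)
  have := (convex_Icc (0 : ℝ) 1).norm_image_sub_le_of_norm_deriv_le
    (f := fun x => P.derivative.eval x) (C := P.derivative.derivative.eval 1)
    (fun z _ => P.derivative.differentiableAt) (fun z hz => ?_) hy hx
  · simpa [Real.norm_eq_abs] using this
  · rw [Polynomial.deriv, Real.norm_eq_abs, abs_of_nonneg (derivative_eval_nonneg hP' hz.1),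
      derivative_eval_eq_sum, derivative_eval_eq_sum]
    refine Finset.sum_le_sum fun j _ => ?_
    refine mul_le_mul_of_nonneg_left ?_ (mul_nonneg (hP' _) (by positivity))
    rw [one_pow]
    exact pow_le_one₀ hz.1 hz.2

end CheckDegrees

/-! ### Packets and checks as one family of independent items -/

section Items

variable (n g m M : ℕ) (P : ℝ[X]) (F : Type*)

/-- The received packets and the check equations, as one family of random items. -/
abbrev Item : Fin m ⊕ Fin M → Type _
  | .inl _ => Packet n g F
  | .inr _ => Check n g F

instance [Fintype F] : ∀ e, Fintype (Item n g m M F e)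
  | .inl _ => inferInstanceAs (Fintype (Packet n g F))
  | .inr _ => inferInstanceAs (Fintype (Check n g F))

/-- The probabilities of the values of an item. -/
noncomputable def itemWeight [Fintype F] : ∀ e, Item n g m M F e → ℝ
  | .inl _ => packetProb n g F
  | .inr _ => checkProb n g P F

/-- The generations connected to an item. -/
def itemSupp : ∀ e, Item n g m M F e → Finset (Fin n)
  | .inl _ => fun p => {p.1}
  | .inr _ => fun c => c.1

/-- The coefficient vectors of an item. -/
def itemVec : ∀ e, Item n g m M F e → Fin n → Fin g → F
  | .inl _ => fun p _ => p.2
  | .inr _ => fun c => c.2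

variable {m M}

/-- The probability that an item is connected to a given generation and that its other generations
belong to a given set of size `a`. -/
noncomputable def itemProb : Fin m ⊕ Fin M → ℕ → ℝ
  | .inl _ => fun _ => (n : ℝ)⁻¹
  | .inr _ => usableProb n P

variable {n g P F} [Fintype F]

lemma itemWeight_nonneg (hP : ∀ d, 0 ≤ P.coeff d) :
    ∀ (e : Fin m ⊕ Fin M) (y : Item n g m M F e), 0 ≤ itemWeight n g m M P F e y
  | .inl _ => fun p => by
    change 0 ≤ packetProb n g F p
    unfold packetProb; positivity
  | .inr _ => fun c => by
    change 0 ≤ checkProb n g P F c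
    have := hP c.1.card
    unfold checkProb; positivity

/-- Support and coefficients of an item are independent, so expectations of products factor. The
one-item probabilities below come from this and from its analogue for checks. -/
lemma sum_packetProb_mul (f : Fin n → ℝ) (h : (Fin g → F) → ℝ) :
    ∑ p : Packet n g F, packetProb n g F p * (f p.1 * h p.2) =
      ((n : ℝ)⁻¹ * ∑ v, f v) * (((Fintype.card F : ℝ) ^ g)⁻¹ * ∑ b, h b) := by
  rw [Fintype.sum_prod_type]
  simp only [packetProb, Finset.mul_sum, Finset.sum_mul]
  rw [Finset.sum_comm]
  exact Finset.sum_congr rfl fun _ _ => Finset.sum_congr rfl fun _ _ => by ring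

lemma sum_checkProb_mul (f : Finset (Fin n) → ℝ) (h : (Fin n → Fin g → F) → ℝ) :
    ∑ c : Check n g F, checkProb n g P F c * (f c.1 * h c.2) =
      (∑ S : Finset (Fin n), P.coeff S.card / n.choose S.card * f S) *
        ((((Fintype.card F : ℝ) ^ g)⁻¹) ^ n * ∑ α, h α) := by
  rw [Fintype.sum_prod_type]
  simp only [checkProb, Finset.mul_sum, Finset.sum_mul]
  rw [Finset.sum_comm]
  exact Finset.sum_congr rfl fun _ _ => Finset.sum_congr rfl fun _ _ => by ring

lemma inv_card_pow_mul_sum_one [Nonempty F] :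
    ((Fintype.card F : ℝ) ^ g)⁻¹ * ∑ _b : Fin g → F, (1 : ℝ) = 1 := by
  have : (Fintype.card F : ℝ) ≠ 0 := by positivity
  simp [this]

lemma inv_card_pow_pow_mul_sum_one [Nonempty F] :
    (((Fintype.card F : ℝ) ^ g)⁻¹) ^ n * ∑ _α : Fin n → Fin g → F, (1 : ℝ) = 1 := by
  have : (Fintype.card F : ℝ) ≠ 0 := by positivity
  simp [this]

/-- Sets are grouped by size; `n` must reach the degree of `P`, since a degree above `n` is realised
by no set. -/
lemma sum_coeff_div_choose (hPsum : P.eval 1 = 1) (hn : P.natDegree ≤ n) :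
    ∑ S : Finset (Fin n), P.coeff S.card / n.choose S.card = 1 := by
  rw [← Finset.powerset_univ, Finset.sum_powerset_apply_card (fun d => P.coeff d / n.choose d),
    Finset.card_univ, Fintype.card_fin]
  rw [eval_eq_sum_range' (n := n + 1) (by omega)] at hPsum
  rw [← hPsum]
  refine Finset.sum_congr rfl fun d hd => ?_
  have : (n.choose d : ℝ) ≠ 0 := by
    exact_mod_cast (Nat.choose_pos (by simp at hd; omega)).ne'
  rw [nsmul_eq_mul]
  field_simp
  simp

/-- Erasing `v` is a bijection from the sets in question to the subsets of `A`, which are then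
grouped by size. -/
lemma sum_coeff_div_choose_usable {A : Finset (Fin n)} {v : Fin n}
    (hv : v ∉ A) :
    ∑ S : Finset (Fin n), P.coeff S.card / n.choose S.card *
      (if v ∈ S ∧ S \ {v} ⊆ A then (1 : ℝ) else 0) = usableProb n P A.card := by
  have h1 : ∑ S : Finset (Fin n), P.coeff S.card / n.choose S.card *
      (if v ∈ S ∧ S \ {v} ⊆ A then (1 : ℝ) else 0) =
      ∑ T ∈ A.powerset, P.coeff (T.card + 1) / n.choose (T.card + 1) := by
    simp only [mul_ite, mul_one, mul_zero]
    rw [← Finset.sum_filter]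
    refine Finset.sum_bij' (fun S _ => S.erase v) (fun T _ => insert v T) ?_ ?_ ?_ ?_ ?_
    · intro S hS
      simp only [Finset.mem_filter, Finset.mem_univ, true_and] at hS
      rw [Finset.mem_powerset, Finset.erase_eq]; exact hS.2
    · intro T hT
      rw [Finset.mem_powerset] at hT
      simp only [Finset.mem_filter, Finset.mem_univ, true_and, Finset.mem_insert_self]
      intro x hx
      simp only [Finset.mem_sdiff, Finset.mem_insert, Finset.mem_singleton] at hx
      exact hT (by tauto)
    · intro S hS
      simp only [Finset.mem_filter, Finset.mem_univ, true_and] at hS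
      exact Finset.insert_erase hS.1
    · intro T hT
      exact Finset.erase_insert fun h => hv (Finset.mem_powerset.1 hT h)
    · intro S hS
      simp only [Finset.mem_filter, Finset.mem_univ, true_and] at hS
      rw [Finset.card_erase_add_one hS.1]
  rw [h1, Finset.sum_powerset_apply_card (fun d => P.coeff (d + 1) / n.choose (d + 1)), usableProb]
  simp only [nsmul_eq_mul]
  have hAn : A.card < n := by
    have := Finset.card_lt_univ_of_notMem hv
    simpa using this
  -- The two ranges are cut to their common part: beyond it either the binomial coefficient or the
  -- coefficient of `P` is zero.
  rw [← Finset.sum_subset (s₁ := Finset.range (min (A.card + 1) P.natDegree)),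
    ← Finset.sum_subset (s₁ := Finset.range (min (A.card + 1) P.natDegree))
      (s₂ := Finset.range P.natDegree)]
  · exact Finset.range_subset_range.2 (min_le_right _ _)
  · intro j hj hj'
    rw [Nat.choose_eq_zero_of_lt (by simp at hj hj'; omega)]; simp
  · exact Finset.range_subset_range.2 (min_le_left _ _)
  · intro j hj hj'
    rw [coeff_eq_zero_of_natDegree_lt (by simp at hj hj'; omega)]; simp

variable [Field F]

lemma sum_itemWeight (hPsum : P.eval 1 = 1) (hn : P.natDegree ≤ n) (hn0 : 0 < n) :
    ∀ e : Fin m ⊕ Fin M, ∑ y, itemWeight n g m M P F e y = 1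
  | .inl _ => by
    have h := sum_packetProb_mul (n := n) (g := g) (F := F) (fun _ => 1) (fun _ => 1)
    rw [inv_card_pow_mul_sum_one] at h
    have hn' : (n : ℝ) ≠ 0 := by positivity
    have h' : ∑ p, packetProb n g F p = 1 := by simpa [hn'] using h
    exact h'
  | .inr _ => by
    have h := sum_checkProb_mul (n := n) (g := g) (F := F) (P := P) (fun _ => 1) (fun _ => 1)
    rw [inv_card_pow_pow_mul_sum_one] at h
    simp only [mul_one, sum_coeff_div_choose hPsum hn] at h
    exact h

lemma sum_itemWeight_usable : ∀ (e : Fin m ⊕ Fin M) (A : Finset (Fin n))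
    (v : Fin n), v ∉ A → ∑ y, itemWeight n g m M P F e y *
      (if v ∈ itemSupp n g m M F e y ∧ itemSupp n g m M F e y \ {v} ⊆ A then 1 else 0) =
      itemProb n P e A.card
  | .inl _ => fun A v hv => by
    have h := sum_packetProb_mul (n := n) (g := g) (F := F) (fun u => if u = v then 1 else 0)
      (fun _ => 1)
    rw [inv_card_pow_mul_sum_one, Finset.sum_ite_eq', if_pos (Finset.mem_univ _), mul_one,
      mul_one] at h
    change _ = (n : ℝ)⁻¹
    rw [← h]
    refine Finset.sum_congr rfl fun p _ => ?_
    change packetProb n g F p * (if v ∈ ({p.1} : Finset _) ∧ {p.1} \ {v} ⊆ A then 1 else 0) = _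
    by_cases hp : p.1 = v
    · simp [hp]
    · simp [hp, Ne.symm hp]
  | .inr _ => fun A v hv => by
    have h := sum_checkProb_mul (n := n) (g := g) (F := F) (P := P)
      (fun S => if v ∈ S ∧ S \ {v} ⊆ A then 1 else 0) (fun _ => 1)
    rw [inv_card_pow_pow_mul_sum_one, mul_one, sum_coeff_div_choose_usable hv] at h
    simp only [mul_one] at h
    exact h

/-- For `x` outside `K` the map `(a, y) ↦ a x + y` is injective on `F × K`; hence a proper subspace
has density at most `1 / q`. -/
lemma card_mul_card_filter_le {V : Type*} [AddCommGroup V] [Module F V] [Fintype V]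
    {K : Submodule F V} (hK : K ≠ ⊤) [DecidablePred (· ∈ K)] :
    Fintype.card F * (Finset.univ.filter fun x => x ∈ K).card ≤ Fintype.card V := by
  obtain ⟨x, hx⟩ : ∃ x, x ∉ K := by
    by_contra! h
    exact hK (eq_top_iff.2 fun x _ => h x)
  rw [← Finset.card_univ, ← Finset.card_univ, ← Finset.card_product]
  refine Finset.card_le_card_of_injOn (fun p => p.1 • x + p.2) (fun _ _ => Finset.mem_univ _) ?_
  rintro ⟨a, y⟩ hy ⟨b, z⟩ hz h
  have hy' : y ∈ K := by simpa using hy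
  have hz' : z ∈ K := by simpa using hz
  have h1 : (a - b) • x = z - y := by
    simp only at h
    rw [sub_smul, sub_eq_sub_iff_add_eq_add, h, add_comm]
  have hab : a = b := by
    by_contra hne
    have h2 : (a - b) • x ∈ K := h1 ▸ K.sub_mem hz' hy'
    exact hx ((K.smul_mem_iff (sub_ne_zero.2 hne)).1 h2)
  subst hab
  simpa using h

lemma sum_itemWeight_supp_le (hP : ∀ d, 0 ≤ P.coeff d) (hn : P.natDegree ≤ n) (hn0 : 0 < n)
    (e : Fin m ⊕ Fin M) (v : Fin n) : ∑ y, itemWeight n g m M P F e y *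
      (if v ∈ itemSupp n g m M F e y then 1 else 0) ≤ (1 + P.derivative.eval 1) / n := by
  -- With all other generations allowed, being usable for `v` just means being connected to `v`.
  have h := sum_itemWeight_usable (P := P) (g := g) (F := F) e (Finset.univ.erase v) v (by simp)
  have h1 : ∀ S : Finset (Fin n), S \ {v} ⊆ Finset.univ.erase v := fun S x hx => by
    simp at hx ⊢; exact hx.2
  simp only [h1, and_true] at h
  rw [h]
  have hn' : (0 : ℝ) < n := by exact_mod_cast hn0
  have h0 := derivative_eval_nonneg hP zero_le_one
  rw [le_div_iff₀ hn']
  rcases e with e | e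
  · change (n : ℝ)⁻¹ * n ≤ _
    rw [inv_mul_cancel₀ hn'.ne']
    linarith
  · change usableProb n P _ * n ≤ _
    have := mul_usableProb_le hP hn (a := (Finset.univ.erase v).card) (by
      rw [Finset.card_erase_of_mem (Finset.mem_univ _)]; simp; omega)
    linarith

/-- The coefficients are uniform and independent of the support, so lying in a proper subspace costs
a further factor `1 / q`. -/
lemma sum_itemWeight_vec_le (hP : ∀ d, 0 ≤ P.coeff d) (hn : P.natDegree ≤ n) (hn0 : 0 < n)
    (e : Fin m ⊕ Fin M) (v : Fin n) (H : Submodule F (Fin g → F)) (hH : H ≠ ⊤) :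
    ∑ y, itemWeight n g m M P F e y *
      (open Classical in
        if v ∈ itemSupp n g m M F e y ∧ itemVec n g m M F e y v ∈ H then 1 else 0) ≤
      (1 + P.derivative.eval 1) / n / Fintype.card F := by
  classical
  have hq : (0 : ℝ) < Fintype.card F := by positivity
  have hs := sum_itemWeight_supp_le (g := g) (F := F) hP hn hn0 e v
  rw [le_div_iff₀ hq]
  refine le_trans ?_ hs
  rcases e with e | e
  · change (∑ p : Packet n g F, packetProb n g F p * (if v ∈ ({p.1} : Finset _) ∧ p.2 ∈ H
      then 1 else 0)) * _ ≤ ∑ p : Packet n g F, packetProb n g F p *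
        (if v ∈ ({p.1} : Finset _) then 1 else 0)
    have h1 := sum_packetProb_mul (n := n) (g := g) (F := F)
      (fun u => if v ∈ ({u} : Finset _) then 1 else 0) (fun b => if b ∈ H then 1 else 0)
    have h2 := sum_packetProb_mul (n := n) (g := g) (F := F)
      (fun u => if v ∈ ({u} : Finset _) then 1 else 0) (fun _ => 1)
    rw [inv_card_pow_mul_sum_one] at h2
    simp only [mul_one] at h2
    simp only [← ite_and, mul_ite, mul_one, mul_zero] at h1 h2 ⊢
    simp only [and_comm] at h1 ⊢
    rw [h1, h2, mul_assoc]
    refine mul_le_of_le_one_right (mul_nonneg (by positivity)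
      (Finset.sum_nonneg fun _ _ => by split_ifs <;> simp)) ?_
    rw [Finset.sum_boole, mul_assoc, inv_mul_le_one₀ (by positivity), mul_comm]
    have := card_mul_card_filter_le hH
    rw [Fintype.card_fun, Fintype.card_fin] at this
    exact_mod_cast this
  · change (∑ c : Check n g F, checkProb n g P F c * (if v ∈ c.1 ∧ c.2 v ∈ H
      then 1 else 0)) * _ ≤ ∑ c : Check n g F, checkProb n g P F c * (if v ∈ c.1 then 1 else 0)
    have h1 := sum_checkProb_mul (n := n) (g := g) (F := F) (P := P)
      (fun S => if v ∈ S then 1 else 0) (fun α => if α v ∈ H then 1 else 0)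
    have h2 := sum_checkProb_mul (n := n) (g := g) (F := F) (P := P)
      (fun S => if v ∈ S then 1 else 0) (fun _ => 1)
    rw [inv_card_pow_pow_mul_sum_one] at h2
    simp only [mul_one] at h2
    simp only [← ite_and, mul_ite, mul_one, mul_zero] at h1 h2 ⊢
    simp only [and_comm] at h1 ⊢
    rw [h1, h2, mul_assoc]
    refine mul_le_of_le_one_right (Finset.sum_nonneg fun S _ => ?_) ?_
    · have := hP S.card
      split_ifs <;> positivity
    · rw [Finset.sum_boole, mul_assoc, inv_pow,
        inv_mul_le_one₀ (by positivity), mul_comm]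
      -- For a check, the condition concerns one block of the coefficients; pulled back along the
      -- surjective projection it still defines a proper subspace.
      have hK : H.comap (LinearMap.proj (R := F) (φ := fun _ : Fin n => Fin g → F) v) ≠ ⊤ := by
        intro htop
        apply hH
        rw [eq_top_iff]
        intro b _
        have : (fun _ => b) ∈ H.comap (LinearMap.proj (R := F) (φ := fun _ : Fin n => Fin g → F) v) :=
          htop ▸ Submodule.mem_top
        exact this
      have := card_mul_card_filter_le hK
      rw [Fintype.card_fun, Fintype.card_fun, Fintype.card_fin, Fintype.card_fin] at this
      simp only [Submodule.mem_comap, LinearMap.proj_apply] at this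
      exact_mod_cast this

end Items

/-! ### Uniform convergence through filters, product estimates, Poisson tails -/

section Helpers

lemma tendsto_iff_eventually_abs_sub_le {κ : Type*} {l : Filter κ} {f : κ → ℝ} {y : ℝ} :
    Tendsto f l (𝓝 y) ↔ ∀ ε > 0, ∀ᶠ c in l, |f c - y| ≤ ε := by
  rw [Metric.tendsto_nhds]
  constructor
  · intro h ε hε
    exact (h ε hε).mono fun c hc => by rw [Real.dist_eq] at hc; exact hc.le
  · intro h ε hε
    exact (h (ε / 2) (by positivity)).mono fun c hc => by rw [Real.dist_eq]; linarith

/-- The filter on pairs `(c, u)` with `p c u` that forces `c` along `l`, uniformly in `u`. -/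
def sigmaFilter {κ : Type*} {T : κ → Type*} (l : Filter κ) (p : ∀ c, T c → Prop) :
    Filter (Σ c, T c) :=
  comap Sigma.fst l ⊓ 𝓟 {x | p x.1 x.2}

variable {κ : Type*} {T : κ → Type*} {l : Filter κ} {p : ∀ c, T c → Prop}

/-- Limits along this filter are limits uniform in `u`. A limit lemma proved for arbitrary filters
therefore yields its own uniform version, which is why `Concentrated` quantifies over all filters.
-/
lemma eventually_sigmaFilter {q : (Σ c, T c) → Prop} :
    (∀ᶠ x in sigmaFilter l p, q x) ↔ ∀ᶠ c in l, ∀ u, p c u → q ⟨c, u⟩ := by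
  rw [sigmaFilter, eventually_inf_principal, eventually_comap]
  refine eventually_congr (Eventually.of_forall fun c => ?_)
  constructor
  · exact fun h u hu => h ⟨c, u⟩ rfl hu
  · rintro h ⟨c', u⟩ rfl hu
    exact h u hu

lemma eventually_sigmaFilter_fst {q : κ → Prop} (h : ∀ᶠ c in l, q c) :
    ∀ᶠ x in sigmaFilter l p, q x.1 :=
  eventually_sigmaFilter.2 (h.mono fun _ hc _ _ => hc)

lemma tendsto_sigmaFilter_fst : Tendsto Sigma.fst (sigmaFilter l p) l :=
  tendsto_comap.mono_left inf_le_left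

lemma tendsto_sigmaFilter {f : (Σ c, T c) → ℝ} {y : ℝ} :
    Tendsto f (sigmaFilter l p) (𝓝 y) ↔
      ∀ ε > 0, ∀ᶠ c in l, ∀ u, p c u → |f ⟨c, u⟩ - y| ≤ ε := by
  simp only [tendsto_iff_eventually_abs_sub_le, eventually_sigmaFilter]

lemma prod_le_pow {ι : Type*} (s : Finset ι) (a : ι → ℝ) {D : ℝ} (ha0 : ∀ e, 0 ≤ a e)
    (ha : ∀ e, a e ≤ D) : ∏ e ∈ s, a e ≤ D ^ s.card := by
  rw [← Finset.prod_const]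
  exact Finset.prod_le_prod (fun e _ => ha0 e) fun e _ => ha e

/-- Factors are exchanged one at a time; `1 ≤ D` makes all the resulting powers comparable. -/
lemma abs_prod_sub_prod_le {ι : Type*} (s : Finset ι) (a b : ι → ℝ) {D δ : ℝ} (hD : 1 ≤ D)
    (hδ : 0 ≤ δ) (ha0 : ∀ e, 0 ≤ a e) (ha : ∀ e, a e ≤ D) (hb0 : ∀ e, 0 ≤ b e) (hb : ∀ e, b e ≤ D)
    (hab : ∀ e, |a e - b e| ≤ δ) :
    |∏ e ∈ s, a e - ∏ e ∈ s, b e| ≤ s.card * D ^ s.card * δ := by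
  classical
  induction s using Finset.induction_on with
  | empty => simp
  | insert e s he ih =>
    rw [Finset.prod_insert he, Finset.prod_insert he, Finset.card_insert_of_notMem he]
    have hA0 : 0 ≤ ∏ e ∈ s, a e := Finset.prod_nonneg fun e _ => ha0 e
    have hA : ∏ e ∈ s, a e ≤ D ^ s.card := prod_le_pow _ _ ha0 ha
    calc |a e * ∏ e ∈ s, a e - b e * ∏ e ∈ s, b e|
        = |(a e - b e) * ∏ e ∈ s, a e + b e * (∏ e ∈ s, a e - ∏ e ∈ s, b e)| := by ring_nf
      _ ≤ |a e - b e| * ∏ e ∈ s, a e + b e * |∏ e ∈ s, a e - ∏ e ∈ s, b e| := by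
          refine (abs_add_le _ _).trans_eq ?_
          rw [abs_mul, abs_mul, abs_of_nonneg hA0, abs_of_nonneg (hb0 e)]
      _ ≤ δ * D ^ s.card + D * (s.card * D ^ s.card * δ) := by
          gcongr
          · exact hab e
          · exact hb e
      _ ≤ D * (δ * D ^ s.card) + D * (s.card * D ^ s.card * δ) := by
          refine add_le_add_left (le_mul_of_one_le_left ?_ hD) _
          positivity
      _ = _ := by push_cast; ring

/-- The probability that a Poisson variable of mean `s` is at least `g`. -/
noncomputable def poissonTail (g : ℕ) (s : ℝ) : ℝ :=
  1 - ∑ j ∈ Finset.range g, Real.exp (-s) * (s ^ j / j.factorial)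

lemma poissonTail_nonneg (g : ℕ) {s : ℝ} (hs : 0 ≤ s) : 0 ≤ poissonTail g s := by
  have := Real.sum_le_exp_of_nonneg hs g
  rw [poissonTail, ← Finset.mul_sum, Real.exp_neg, sub_nonneg, inv_mul_le_one₀ (Real.exp_pos s)]
  exact this

/-- The term `j = 0` is positive. Strictness is what later permits division by `1 - x_j`. -/
lemma poissonTail_lt_one {g : ℕ} (hg : 1 ≤ g) {s : ℝ} (hs : 0 ≤ s) : poissonTail g s < 1 := by
  rw [poissonTail, sub_lt_self_iff]
  exact Finset.sum_pos' (fun j _ => by positivity)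
    ⟨0, Finset.mem_range.2 (by omega), by simp [Real.exp_pos]⟩

end Helpers

-- Families of codes: constants and uniform bounds

universe u

/-- A sequence of random systems of received packets and check equations. -/
structure CodeFamily where
  g : ℕ
  one_le_g : 1 ≤ g
  P : ℝ[X]
  coeff_nonneg : ∀ d, 0 ≤ P.coeff d
  eval_one : P.eval 1 = 1
  F : ℕ → Type u
  [field : ∀ k, Field (F k)]
  [fintype : ∀ k, Fintype (F k)]
  n : ℕ → ℕ
  m : ℕ → ℕ
  M : ℕ → ℕ
  r : ℝ
  β : ℝ
  tendsto_card : Tendsto (fun k => Fintype.card (F k)) atTop atTop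
  tendsto_n : Tendsto n atTop atTop
  tendsto_m : Tendsto (fun k => (m k : ℝ) / n k) atTop (𝓝 r)
  tendsto_M : Tendsto (fun k => (M k : ℝ) / n k) atTop (𝓝 β)

namespace CodeFamily

attribute [instance] CodeFamily.field CodeFamily.fintype

variable (C : CodeFamily.{u})

abbrev Index (k : ℕ) : Type := Fin (C.m k) ⊕ Fin (C.M k)

abbrev Outcome (k : ℕ) : Type u := ∀ e : C.Index k, Item (C.n k) C.g (C.m k) (C.M k) (C.F k) e

/-- The expectation in the `k`-th system. -/
noncomputable def avg (k : ℕ) (X : C.Outcome k → ℝ) : ℝ :=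
  prodExpect (itemWeight (C.n k) C.g (C.m k) (C.M k) C.P (C.F k)) X

variable {k : ℕ}

/-- The peeling process of the `k`-th system. -/
noncomputable def peeled (ω : C.Outcome k) (V : Finset (Fin (C.n k))) (E : Finset (C.Index k))
    (t : ℕ) : Finset (Fin (C.n k)) :=
  peelAt (itemSupp (C.n k) C.g (C.m k) (C.M k) (C.F k))
    (itemVec (C.n k) C.g (C.m k) (C.M k) (C.F k)) ω V E t

/-- The usable items of `v` in the `k`-th system. -/
noncomputable def usables (ω : C.Outcome k) (V : Finset (Fin (C.n k))) (E : Finset (C.Index k))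
    (t : ℕ) (v : Fin (C.n k)) : Finset (C.Index k) :=
  usableAt (itemSupp (C.n k) C.g (C.m k) (C.M k) (C.F k))
    (itemVec (C.n k) C.g (C.m k) (C.M k) (C.F k)) ω V E t v

/-- The fraction of peeled generations. -/
noncomputable def density (ω : C.Outcome k) (V : Finset (Fin (C.n k))) (E : Finset (C.Index k))
    (t : ℕ) : ℝ :=
  (C.peeled ω V E t).card / C.n k

/-- The limit of the expected fraction of peeled generations. -/
noncomputable def limit : ℕ → ℝ
  | 0 => 0
  | t + 1 => poissonTail C.g (C.r + C.β * C.P.derivative.eval (limit t))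

/-- The limiting rate of usable items in round `t + 1`. -/
noncomputable def rate (t : ℕ) : ℝ := C.r + C.β * C.P.derivative.eval (C.limit t)

lemma r_nonneg : 0 ≤ C.r :=
  ge_of_tendsto C.tendsto_m (Eventually.of_forall fun k => by positivity)

lemma β_nonneg : 0 ≤ C.β :=
  ge_of_tendsto C.tendsto_M (Eventually.of_forall fun k => by positivity)

lemma limit_mem (t : ℕ) : 0 ≤ C.limit t ∧ C.limit t < 1 := by
  induction t with
  | zero => simp [limit]
  | succ t ih =>
    have h : 0 ≤ C.r + C.β * C.P.derivative.eval (C.limit t) :=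
      add_nonneg C.r_nonneg (mul_nonneg C.β_nonneg (derivative_eval_nonneg C.coeff_nonneg ih.1))
    exact ⟨poissonTail_nonneg _ h, poissonTail_lt_one C.one_le_g h⟩

/-- A bound for the rescaled item probabilities. -/
noncomputable def bound : ℝ := 1 + C.P.derivative.eval 1

lemma one_le_bound : 1 ≤ C.bound := by
  have := derivative_eval_nonneg C.coeff_nonneg zero_le_one
  unfold bound; linarith

/-- The limiting rescaled probability that an item is usable when a fraction `x` is peeled. -/
noncomputable def slope (x : ℝ) : C.Index k → ℝ :=
  Sum.elim (fun _ => 1) (fun _ => C.P.derivative.eval x)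

lemma slope_nonneg {x : ℝ} (hx : 0 ≤ x) (e : C.Index k) : 0 ≤ C.slope x e := by
  rcases e with e | e
  · exact zero_le_one
  · exact derivative_eval_nonneg C.coeff_nonneg hx

lemma slope_le {x : ℝ} (hx : 0 ≤ x) (hx1 : x ≤ 1) (e : C.Index k) : C.slope x e ≤ C.bound := by
  have h := C.one_le_bound
  rcases e with e | e
  · exact h
  · change C.P.derivative.eval x ≤ _
    refine le_trans ?_ (le_add_of_nonneg_left zero_le_one)
    rw [derivative_eval_eq_sum, derivative_eval_eq_sum]
    exact Finset.sum_le_sum fun j _ => mul_le_mul_of_nonneg_left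
      (pow_le_pow_left₀ hx hx1 j) (mul_nonneg (C.coeff_nonneg _) (by positivity))

/-- The error in approximating a rescaled item probability. -/
noncomputable def err (k : ℕ) : ℝ :=
  C.P.derivative.eval 1 * (C.P.natDegree ^ 2 / (C.n k - C.P.natDegree))

lemma tendsto_cast_n : Tendsto (fun k => (C.n k : ℝ)) atTop atTop :=
  tendsto_natCast_atTop_atTop.comp C.tendsto_n

lemma tendsto_err : Tendsto C.err atTop (𝓝 0) := by
  have h : Tendsto (fun k => (C.n k : ℝ) - C.P.natDegree) atTop atTop :=
    tendsto_atTop_add_const_right _ _ C.tendsto_cast_n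
  have := (h.const_div_atTop ((C.P.natDegree : ℝ) ^ 2)).const_mul (C.P.derivative.eval 1)
  rwa [mul_zero] at this

lemma err_nonneg (hk : C.P.natDegree < C.n k) : 0 ≤ C.err k := by
  have h1 := derivative_eval_nonneg C.coeff_nonneg zero_le_one
  have h2 : (C.P.natDegree : ℝ) < C.n k := by exact_mod_cast hk
  have h3 : (0 : ℝ) < C.n k - C.P.natDegree := by linarith
  unfold err; positivity

lemma eventually_natDegree_lt : ∀ᶠ k in atTop, C.P.natDegree < C.n k :=
  C.tendsto_n.eventually_gt_atTop _

lemma mul_itemProb_nonneg (e : C.Index k) (a : ℕ) : 0 ≤ C.n k * itemProb (C.n k) C.P e a := by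
  rcases e with e | e
  · change 0 ≤ (C.n k : ℝ) * (C.n k : ℝ)⁻¹
    positivity
  · exact mul_nonneg (by positivity) (usableProb_nonneg C.coeff_nonneg _ _)

lemma mul_itemProb_le (hk : C.P.natDegree < C.n k) (e : C.Index k) {a : ℕ} (ha : a < C.n k) :
    C.n k * itemProb (C.n k) C.P e a ≤ C.bound := by
  rcases e with e | e
  · change (C.n k : ℝ) * (C.n k : ℝ)⁻¹ ≤ _
    exact mul_inv_le_one.trans C.one_le_bound
  · exact (mul_usableProb_le C.coeff_nonneg hk.le ha).trans
      (le_add_of_nonneg_left zero_le_one)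

/-- The Lipschitz constant of the rescaled item probabilities. -/
noncomputable def lip : ℝ := C.P.derivative.derivative.eval 1

lemma lip_nonneg : 0 ≤ C.lip := by
  refine derivative_eval_nonneg (fun d => ?_) zero_le_one
  rw [coeff_derivative]; exact mul_nonneg (C.coeff_nonneg _) (by positivity)

lemma abs_mul_usableProb_sub_derivative_le (hk : C.P.natDegree < C.n k) {a : ℕ} (ha : a < C.n k)
    {x : ℝ} (hx : 0 ≤ x) (hx1 : x ≤ 1) :
    |C.n k * usableProb (C.n k) C.P a - C.P.derivative.eval x| ≤
      C.lip * |(a : ℝ) / C.n k - x| + C.err k := by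
  have hn : (0 : ℝ) < C.n k := by exact_mod_cast (by omega : 0 < C.n k)
  have h1 := abs_mul_usableProb_sub_le C.coeff_nonneg hk ha
  have h2 := abs_derivative_eval_sub_le C.coeff_nonneg (x := (a : ℝ) / C.n k) (y := x)
    ⟨by positivity, by rw [div_le_one hn]; exact_mod_cast ha.le⟩ ⟨hx, hx1⟩
  have := abs_sub_le (C.n k * usableProb (C.n k) C.P a) (C.P.derivative.eval ((a : ℝ) / C.n k))
    (C.P.derivative.eval x)
  unfold lip err
  linarith

lemma abs_mul_itemProb_sub_slope_le (hk : C.P.natDegree < C.n k) (e : C.Index k) {a : ℕ}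
    (ha : a < C.n k) {x : ℝ} (hx : 0 ≤ x) (hx1 : x ≤ 1) :
    |C.n k * itemProb (C.n k) C.P e a - C.slope x e| ≤
      C.lip * |(a : ℝ) / C.n k - x| + C.err k := by
  have hn : (0 : ℝ) < C.n k := by exact_mod_cast (by omega : 0 < C.n k)
  rcases e with e | e
  · change |(C.n k : ℝ) * (C.n k : ℝ)⁻¹ - 1| ≤ _
    rw [mul_inv_cancel₀ hn.ne', sub_self, abs_zero]
    exact add_nonneg (mul_nonneg C.lip_nonneg (abs_nonneg _)) (C.err_nonneg hk)
  · exact C.abs_mul_usableProb_sub_derivative_le hk ha hx hx1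

lemma weight_nonneg (k : ℕ) : ∀ e y,
    0 ≤ itemWeight (C.n k) C.g (C.m k) (C.M k) C.P (C.F k) e y :=
  itemWeight_nonneg C.coeff_nonneg

lemma sum_weight (hk : C.P.natDegree < C.n k) (e : C.Index k) :
    ∑ y, itemWeight (C.n k) C.g (C.m k) (C.M k) C.P (C.F k) e y = 1 :=
  sum_itemWeight C.eval_one hk.le (by omega) e

lemma density_nonneg (ω : C.Outcome k) (V : Finset (Fin (C.n k))) (E : Finset (C.Index k))
    (t : ℕ) : 0 ≤ C.density ω V E t := by unfold density; positivity

lemma density_le_one (ω : C.Outcome k) (V : Finset (Fin (C.n k))) (E : Finset (C.Index k))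
    (t : ℕ) : C.density ω V E t ≤ 1 := by
  refine div_le_one_of_le₀ ?_ (by positivity)
  exact_mod_cast (Finset.card_le_univ _).trans_eq (Fintype.card_fin _)

/-- A frozen generation is never peeled; this provides the strict inequality assumed in the
estimates of `usableProb`. -/
lemma card_peeled_lt (ω : C.Outcome k) {V : Finset (Fin (C.n k))} {v : Fin (C.n k)} (hv : v ∈ V)
    (E : Finset (C.Index k)) (t : ℕ) : (C.peeled ω V E t).card < C.n k := by
  have := Finset.card_lt_univ_of_notMem (notMem_peel (S := fun e => itemSupp _ _ _ _ _ e (ω e))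
    (α := fun e => itemVec _ _ _ _ _ e (ω e)) (E := E) hv t)
  rwa [Fintype.card_fin] at this

/-- The fraction of peeled generations after `t` rounds is concentrated, uniformly over boundedly
many frozen generations and removed items. -/
def Concentrated (t : ℕ) : Prop :=
  ∀ (κ : Type) (l : Filter κ) (k : κ → ℕ), Tendsto k l atTop →
    ∀ (s : ℕ) (V : ∀ c, Finset (Fin (C.n (k c)))) (E : ∀ c, Finset (C.Index (k c))),
      (∀ᶠ c in l, (V c).card ≤ s) → (∀ᶠ c in l, (E c).card ≤ s) →
      Tendsto (fun c => C.avg (k c) fun ω => |C.density ω (V c) (E c) t - C.limit t|) l (𝓝 0)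

/-! ### Poisson law for the number of usable items of a frozen generation -/

variable {C} {t : ℕ} {κ : Type} {l : Filter κ} {k : κ → ℕ}

/-- The product depends on the outcome only through the density, in a Lipschitz way, so by
concentration it can be replaced in mean by its value at the limit; `ψ` then contributes only its
own mean. -/
lemma tendsto_avg_prod (hC : C.Concentrated t) (hk : Tendsto k l atTop) {s j : ℕ}
    {U : ∀ c, Finset (Fin (C.n (k c)))} {E T : ∀ c, Finset (C.Index (k c))}
    {v : ∀ c, Fin (C.n (k c))} (hv : ∀ c, v c ∈ U c)
    (hU : ∀ᶠ c in l, (U c).card ≤ s) (hE : ∀ᶠ c in l, (E c).card ≤ s)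
    (hT : ∀ᶠ c in l, (T c).card = j) {ψ : ∀ c, C.Outcome (k c) → ℝ} (hψ0 : ∀ c ω, 0 ≤ ψ c ω)
    (hψ1 : ∀ c ω, ψ c ω ≤ 1) {y : ℝ} (hy : Tendsto (fun c => C.avg (k c) (ψ c)) l (𝓝 y)) :
    Tendsto (fun c => C.avg (k c) (fun ω => (∏ e ∈ T c, C.n (k c) *
        itemProb (C.n (k c)) C.P e (C.peeled ω (U c) (E c) t).card) * ψ c ω) -
      y * ∏ e ∈ T c, C.slope (C.limit t) e) l (𝓝 0) := by
  have hlim : Tendsto (fun c => j * C.bound ^ j * (C.lip *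
      (C.avg (k c) fun ω => |C.density ω (U c) (E c) t - C.limit t|) + C.err (k c)) +
      |C.avg (k c) (ψ c) - y| * C.bound ^ j) l (𝓝 0) := by
    have h1 := (((hC κ l k hk s U E hU hE).const_mul C.lip).add
      (C.tendsto_err.comp hk)).const_mul (j * C.bound ^ j)
    have h2 := ((hy.sub_const y).abs).mul_const (C.bound ^ j)
    simpa using h1.add h2
  refine squeeze_zero_norm' ?_ hlim
  filter_upwards [hT, hk.eventually C.eventually_natDegree_lt] with c hTc hkc
  rw [Real.norm_eq_abs]
  have hx := C.limit_mem t
  have hb0 : (0 : ℝ) ≤ C.bound := zero_le_one.trans C.one_le_bound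
  set A : C.Outcome (k c) → ℝ := fun ω => ∏ e ∈ T c, C.n (k c) *
        itemProb (C.n (k c)) C.P e (C.peeled ω (U c) (E c) t).card
  set B : ℝ := ∏ e ∈ T c, C.slope (C.limit t) e
  have hB0 : 0 ≤ B := Finset.prod_nonneg fun e _ => C.slope_nonneg hx.1 e
  have hB : B ≤ C.bound ^ j := by
    rw [← hTc]
    exact prod_le_pow _ _ (C.slope_nonneg hx.1) (C.slope_le hx.1 hx.2.le)
  have hpt : ∀ ω, |(A ω - B) * ψ c ω| ≤ j * C.bound ^ j * (C.lip *
      |C.density ω (U c) (E c) t - C.limit t| + C.err (k c)) := by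
    intro ω
    have hlt := C.card_peeled_lt ω (hv c) (E c) t
    rw [abs_mul, abs_of_nonneg (hψ0 c ω)]
    refine (mul_le_of_le_one_right (abs_nonneg _) (hψ1 c ω)).trans ?_
    have := abs_prod_sub_prod_le (T c) (fun e => C.n (k c) *
        itemProb (C.n (k c)) C.P e (C.peeled ω (U c) (E c) t).card)
        (fun e => C.slope (C.limit t) e) C.one_le_bound
        (add_nonneg (mul_nonneg C.lip_nonneg (abs_nonneg _)) (C.err_nonneg hkc))
        (fun e => C.mul_itemProb_nonneg e _) (fun e => C.mul_itemProb_le hkc e hlt)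
        (fun e => C.slope_nonneg hx.1 e) (fun e => C.slope_le hx.1 hx.2.le e)
        (fun e => C.abs_mul_itemProb_sub_slope_le hkc e hlt hx.1 hx.2.le)
    rw [hTc] at this
    exact this
  have hsplit : C.avg (k c) (fun ω => A ω * ψ c ω) - y * B =
      C.avg (k c) (fun ω => (A ω - B) * ψ c ω) + (C.avg (k c) (ψ c) - y) * B := by
    have : C.avg (k c) (fun ω => A ω * ψ c ω) =
        C.avg (k c) (fun ω => (A ω - B) * ψ c ω) + B * C.avg (k c) (ψ c) := by
      rw [avg, avg, avg, ← prodExpect_mul_left, ← prodExpect_add]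
      congr 1; ext ω; ring
    rw [this]; ring
  rw [hsplit]
  refine (abs_add_le _ _).trans (add_le_add ?_ ?_)
  · refine (abs_prodExpect_le (C.weight_nonneg _) _).trans
      ((prodExpect_mono (C.weight_nonneg _) hpt).trans_eq ?_)
    rw [prodExpect_mul_left, prodExpect_add, prodExpect_mul_left,
      prodExpect_const (C.sum_weight hkc)]
    rfl
  · rw [abs_mul, abs_of_nonneg hB0]
    exact mul_le_mul_of_nonneg_left hB (abs_nonneg _)

/-- The packets contribute `m / n`, the checks `(M / n) P'(x)`, and boundedly many removed items are
negligible. -/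
lemma tendsto_sum_slope_div (hk : Tendsto k l atTop) {s : ℕ}
    {E : ∀ c, Finset (C.Index (k c))} (hE : ∀ᶠ c in l, (E c).card ≤ s) :
    Tendsto (fun c => ∑ e ∈ Finset.univ \ E c, C.slope (C.limit t) e / C.n (k c)) l
      (𝓝 (C.rate t)) := by
  have hx := C.limit_mem t
  have h1 : Tendsto (fun c => (C.m (k c) : ℝ) / C.n (k c) +
      (C.M (k c) : ℝ) / C.n (k c) * C.P.derivative.eval (C.limit t)) l (𝓝 (C.rate t)) :=
    (C.tendsto_m.comp hk).add ((C.tendsto_M.comp hk).mul_const _)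
  have h2 : Tendsto (fun c => s * (C.bound / C.n (k c))) l (𝓝 0) := by
    simpa using ((C.tendsto_cast_n.comp hk).const_div_atTop C.bound).const_mul (s : ℝ)
  have h3 : Tendsto (fun c => ∑ e ∈ E c, C.slope (C.limit t) e / C.n (k c)) l (𝓝 0) := by
    refine squeeze_zero' (Eventually.of_forall fun c => Finset.sum_nonneg fun e _ =>
      div_nonneg (C.slope_nonneg hx.1 e) (by positivity)) (hE.mono fun c hc => ?_) h2
    have hb : 0 ≤ C.bound / C.n (k c) :=
      div_nonneg (zero_le_one.trans C.one_le_bound) (by positivity)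
    calc ∑ e ∈ E c, C.slope (C.limit t) e / C.n (k c) ≤ ∑ e ∈ E c, C.bound / C.n (k c) :=
          Finset.sum_le_sum fun e _ =>
            div_le_div_of_nonneg_right (C.slope_le hx.1 hx.2.le e) (by positivity)
      _ = (E c).card * (C.bound / C.n (k c)) := by rw [Finset.sum_const, nsmul_eq_mul]
      _ ≤ _ := mul_le_mul_of_nonneg_right (by exact_mod_cast hc) hb
  have h4 := h1.sub h3
  rw [sub_zero] at h4
  refine h4.congr fun c => ?_
  rw [sub_eq_iff_eq_add, Finset.sum_sdiff (Finset.subset_univ _), Fintype.sum_sum_type]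
  simp only [slope, Sum.elim_inl, Sum.elim_inr, Finset.sum_const, Finset.card_univ,
    Fintype.card_fin, nsmul_eq_mul]
  ring

/-- A bound for the number of items per generation. -/
lemma eventually_card_index_le (C : CodeFamily.{u}) :
    ∀ᶠ k in atTop, (Fintype.card (C.Index k) : ℝ) / C.n k ≤ C.r + C.β + 1 := by
  have h := C.tendsto_m.add C.tendsto_M
  refine (h.eventually_le_const (lt_add_one _)).mono fun k hk => ?_
  simpa [add_div] using hk

lemma choose_mul_div_pow_le {L n j : ℕ} {D : ℝ} (hD : 0 ≤ D) :
    (L.choose j : ℝ) * (D / n) ^ j ≤ ((L : ℝ) / n * D) ^ j / j.factorial := by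
  calc (L.choose j : ℝ) * (D / n) ^ j ≤ (L : ℝ) ^ j / j.factorial * (D / n) ^ j := by
        gcongr
        exact Nat.choose_le_pow_div j L
    _ = _ := by rw [div_mul_eq_mul_div, ← mul_pow]; ring_nf

/-- A test functional: one for each set of removed items, bounded, not depending on the removed
items, and insensitive to the removal of items that are connected to the generation `v`. -/
structure IsTest {k : ℕ} (C : CodeFamily.{u}) (v : Fin (C.n k))
    (ψ : Finset (C.Index k) → C.Outcome k → ℝ) : Prop where
  nonneg : ∀ E ω, 0 ≤ ψ E ω
  le_one : ∀ E ω, ψ E ω ≤ 1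
  union : ∀ E E' ω, (∀ e ∈ E', v ∈ itemSupp (C.n k) C.g (C.m k) (C.M k) (C.F k) e (ω e)) →
    ψ (E ∪ E') ω = ψ E ω
  update : ∀ E, ∀ e ∈ E, ∀ (ω : C.Outcome k) y, ψ E (Function.update ω e y) = ψ E ω

lemma avg_mul_choose {k : ℕ} {v : Fin (C.n k)} {ψ : Finset (C.Index k) → C.Outcome k → ℝ}
    (hψ : IsTest C v ψ) (hk : C.P.natDegree < C.n k) {U : Finset (Fin (C.n k))} (hv : v ∈ U)
    (E : Finset (C.Index k)) (j : ℕ) :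
    C.avg k (fun ω => ψ E ω * ((C.usables ω U E t v).card.choose j : ℕ)) =
      ∑ T ∈ Finset.powersetCard j (Finset.univ \ E), C.avg k (fun ω =>
        (∏ e ∈ T, itemProb (C.n k) C.P e (C.peeled ω U (E ∪ T) t).card) * ψ (E ∪ T) ω) :=
  prodExpect_mul_choose (C.sum_weight hk) (fun e A v hv => sum_itemWeight_usable e A v hv) hv E ψ
    (fun E' ω h => hψ.union E E' ω h) (fun E' e he ω y => hψ.update E' e he ω y) j t

lemma prod_itemProb {k : ℕ} (hk : C.P.natDegree < C.n k) (T : Finset (C.Index k)) (a : ℕ) :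
    ∏ e ∈ T, itemProb (C.n k) C.P e a =
      ((C.n k : ℝ)⁻¹) ^ T.card * ∏ e ∈ T, C.n k * itemProb (C.n k) C.P e a := by
  have hn : (C.n k : ℝ) ≠ 0 := by exact_mod_cast (by omega : C.n k ≠ 0)
  rw [Finset.prod_mul_distrib, Finset.prod_const, ← mul_assoc, ← mul_pow, inv_mul_cancel₀ hn,
    one_pow, one_mul]

lemma avg_mul_choose_nonneg {k : ℕ} {v : Fin (C.n k)}
    {ψ : Finset (C.Index k) → C.Outcome k → ℝ} (hψ : IsTest C v ψ)
    (U : Finset (Fin (C.n k))) (E : Finset (C.Index k)) (j : ℕ) :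
    0 ≤ C.avg k (fun ω => ψ E ω * ((C.usables ω U E t v).card.choose j : ℕ)) :=
  prodExpect_nonneg (C.weight_nonneg k) fun ω => mul_nonneg (hψ.nonneg E ω) (Nat.cast_nonneg _)

/-- The factorial in this bound, uniform in the system, supplies the summable majorant for the
inclusion-exclusion series. -/
lemma avg_mul_choose_le {k : ℕ} {v : Fin (C.n k)} {ψ : Finset (C.Index k) → C.Outcome k → ℝ}
    (hψ : IsTest C v ψ) (hk : C.P.natDegree < C.n k)
    (hL : (Fintype.card (C.Index k) : ℝ) / C.n k ≤ C.r + C.β + 1)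
    {U : Finset (Fin (C.n k))} (hv : v ∈ U)
    (E : Finset (C.Index k)) (j : ℕ) :
    C.avg k (fun ω => ψ E ω * ((C.usables ω U E t v).card.choose j : ℕ)) ≤
      ((C.r + C.β + 1) * C.bound) ^ j / j.factorial := by
  have hb := zero_le_one.trans C.one_le_bound
  rw [avg_mul_choose hψ hk hv]
  have hterm : ∀ T ∈ Finset.powersetCard j (Finset.univ \ E), C.avg k (fun ω =>
      (∏ e ∈ T, itemProb (C.n k) C.P e (C.peeled ω U (E ∪ T) t).card) * ψ (E ∪ T) ω) ≤
      (C.bound / C.n k) ^ j := by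
    intro T hT
    have hTc := (Finset.mem_powersetCard.1 hT).2
    refine prodExpect_le (C.weight_nonneg k) (C.sum_weight hk) fun ω => ?_
    rw [prod_itemProb hk, hTc, div_eq_inv_mul, mul_pow]
    have h1 : ∏ e ∈ T, C.n k * itemProb (C.n k) C.P e (C.peeled ω U (E ∪ T) t).card ≤
        C.bound ^ j := by
      rw [← hTc]
      exact prod_le_pow _ _ (fun e => C.mul_itemProb_nonneg e _)
        (fun e => C.mul_itemProb_le hk e (C.card_peeled_lt ω hv _ t))
    refine (mul_le_of_le_one_right (mul_nonneg (by positivity)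
      (Finset.prod_nonneg fun e _ => C.mul_itemProb_nonneg e _)) (hψ.le_one _ _)).trans ?_
    exact mul_le_mul_of_nonneg_left h1 (by positivity)
  refine (Finset.sum_le_card_nsmul _ _ _ hterm).trans ?_
  rw [Finset.card_powersetCard, nsmul_eq_mul]
  calc _ ≤ ((Fintype.card (C.Index k)).choose j : ℝ) * (C.bound / C.n k) ^ j := by
        gcongr
        exact Finset.card_le_univ _
    _ ≤ _ := (choose_mul_div_pow_le hb).trans (by gcongr)

/-- The binomial moments of the number of usable items of a frozen generation converge to those of
a Poisson variable, also in the presence of a test functional. -/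
lemma tendsto_avg_mul_choose (hC : C.Concentrated t) (hk : Tendsto k l atTop) {s : ℕ}
    {U : ∀ c, Finset (Fin (C.n (k c)))} {E : ∀ c, Finset (C.Index (k c))}
    {v : ∀ c, Fin (C.n (k c))} (hv : ∀ c, v c ∈ U c)
    (hU : ∀ᶠ c in l, (U c).card ≤ s) (hE : ∀ᶠ c in l, (E c).card ≤ s)
    {ψ : ∀ c, Finset (C.Index (k c)) → C.Outcome (k c) → ℝ} (hψ : ∀ c, IsTest C (v c) (ψ c))
    {y : ℝ} (hy : ∀ j : ℕ, ∀ ε > 0, ∀ᶠ c in l, ∀ T : Finset (C.Index (k c)), T.card = j →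
      |C.avg (k c) (ψ c (E c ∪ T)) - y| ≤ ε) (j : ℕ) :
    Tendsto (fun c => C.avg (k c)
        (fun ω => ψ c (E c) ω * ((C.usables ω (U c) (E c) t (v c)).card.choose j : ℕ))) l
      (𝓝 (y * (C.rate t ^ j / j.factorial))) := by
  have hx := C.limit_mem t
  -- The error must be small simultaneously for all `j`-sets `T`, so the pair `(c, T)` is taken as
  -- index.
  have hunif := tendsto_sigmaFilter.1 (tendsto_avg_prod (C := C) (t := t)
    (κ := Σ c, Finset (C.Index (k c))) (l := sigmaFilter l fun _ T => T.card = j)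
    (k := fun x => k x.1) (s := s + j) (j := j) (U := fun x => U x.1) (E := fun x => E x.1 ∪ x.2)
    (T := fun x => x.2) (v := fun x => v x.1) (ψ := fun x => ψ x.1 (E x.1 ∪ x.2)) (y := y)
    hC (hk.comp tendsto_sigmaFilter_fst) (fun x => hv x.1)
    (eventually_sigmaFilter_fst (hU.mono fun c hc => hc.trans (by omega)))
    (eventually_sigmaFilter.2 (hE.mono fun c hc T hT =>
      (Finset.card_union_le _ _).trans (by simp only; omega)))
    (eventually_sigmaFilter.2 (Eventually.of_forall fun c T hT => hT))
    (fun x => (hψ x.1).nonneg _) (fun x => (hψ x.1).le_one _)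
    (tendsto_sigmaFilter.2 (hy j)))
  have hes : Tendsto (fun c => y * ∑ T ∈ Finset.powersetCard j (Finset.univ \ E c),
      ∏ e ∈ T, C.slope (C.limit t) e / C.n (k c)) l (𝓝 (y * (C.rate t ^ j / j.factorial))) := by
    refine Tendsto.const_mul y (tendsto_sum_powersetCard_prod E
      (fun c e => C.slope (C.limit t) e / C.n (k c))
      (fun c e => div_nonneg (C.slope_nonneg hx.1 e) (by positivity))
      (δ := fun c => C.bound / C.n (k c))
      (Eventually.of_forall fun c e =>
        div_le_div_of_nonneg_right (C.slope_le hx.1 hx.2.le e) (by positivity))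
      ((C.tendsto_cast_n.comp hk).const_div_atTop _) (tendsto_sum_slope_div hk hE) j)
  suffices hdiff : Tendsto (fun c => C.avg (k c)
        (fun ω => ψ c (E c) ω * ((C.usables ω (U c) (E c) t (v c)).card.choose j : ℕ)) -
      y * ∑ T ∈ Finset.powersetCard j (Finset.univ \ E c),
        ∏ e ∈ T, C.slope (C.limit t) e / C.n (k c)) l (𝓝 0) by
    simpa using hdiff.add hes
  -- There are eventually at most `B n ^ j` sets `T`, and each will contribute an error of at most
  -- `n ^ (-j) ε / B`.
  set B : ℝ := (C.r + C.β + 1) ^ j with hB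
  have hB0 : 0 < B := by
    have h1 := C.r_nonneg
    have h2 := C.β_nonneg
    positivity
  rw [tendsto_iff_eventually_abs_sub_le]
  intro ε hε
  filter_upwards [hunif (ε / B) (by positivity), hk.eventually C.eventually_natDegree_lt,
    hk.eventually C.eventually_card_index_le] with c hc hkc hLc
  have hn : (0 : ℝ) < C.n (k c) := by exact_mod_cast (by omega : 0 < C.n (k c))
  rw [sub_zero, avg_mul_choose (hψ c) hkc (hv c), Finset.mul_sum, ← Finset.sum_sub_distrib]
  have hterm : ∀ T ∈ Finset.powersetCard j (Finset.univ \ E c),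
      |C.avg (k c) (fun ω => (∏ e ∈ T, itemProb (C.n (k c)) C.P e
        (C.peeled ω (U c) (E c ∪ T) t).card) * ψ c (E c ∪ T) ω) -
        y * ∏ e ∈ T, C.slope (C.limit t) e / C.n (k c)| ≤
      ((C.n (k c) : ℝ)⁻¹) ^ j * (ε / B) := by
    intro T hT
    have hTc := (Finset.mem_powersetCard.1 hT).2
    have h1 := hc T hTc
    rw [sub_zero] at h1
    have h2 : C.avg (k c) (fun ω => (∏ e ∈ T, itemProb (C.n (k c)) C.P e
        (C.peeled ω (U c) (E c ∪ T) t).card) * ψ c (E c ∪ T) ω) =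
        ((C.n (k c) : ℝ)⁻¹) ^ j * C.avg (k c) (fun ω => (∏ e ∈ T, C.n (k c) *
          itemProb (C.n (k c)) C.P e (C.peeled ω (U c) (E c ∪ T) t).card) * ψ c (E c ∪ T) ω) := by
      rw [avg, avg, ← prodExpect_mul_left]
      congr 1; ext ω
      rw [prod_itemProb hkc, hTc, mul_assoc]
    have h3 : ∏ e ∈ T, C.slope (C.limit t) e / C.n (k c) =
        ((C.n (k c) : ℝ)⁻¹) ^ j * ∏ e ∈ T, C.slope (C.limit t) e := by
      simp only [div_eq_inv_mul]
      rw [Finset.prod_mul_distrib, Finset.prod_const, hTc]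
    rw [h2, h3, mul_left_comm, ← mul_sub, abs_mul, abs_of_nonneg (by positivity)]
    exact mul_le_mul_of_nonneg_left h1 (by positivity)
  refine (Finset.abs_sum_le_sum_abs _ _).trans ((Finset.sum_le_card_nsmul _ _ _ hterm).trans ?_)
  rw [Finset.card_powersetCard, nsmul_eq_mul]
  have hch : (((Finset.univ \ E c).card.choose j : ℕ) : ℝ) ≤
      (Fintype.card (C.Index (k c)) : ℝ) ^ j := by
    exact_mod_cast (Nat.choose_le_choose j (Finset.card_le_univ _)).trans (Nat.choose_le_pow _ _)
  calc _ ≤ (Fintype.card (C.Index (k c)) : ℝ) ^ j * (((C.n (k c) : ℝ)⁻¹) ^ j * (ε / B)) := by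
        gcongr
    _ = ((Fintype.card (C.Index (k c)) : ℝ) / C.n (k c)) ^ j * (ε / B) := by
        rw [div_eq_mul_inv (Fintype.card (C.Index (k c)) : ℝ), mul_pow]; ring
    _ ≤ B * (ε / B) := by
        refine mul_le_mul_of_nonneg_right ?_ (by positivity)
        exact pow_le_pow_left₀ (by positivity) hLc j
    _ = ε := by field_simp

/-- Moments are converted into the weights of exactly `j` usable items; those with `j < g` are
subtracted from the total mass `y`. -/
lemma tendsto_avg_mul_ite (hC : C.Concentrated t) (hk : Tendsto k l atTop) {s : ℕ}
    {U : ∀ c, Finset (Fin (C.n (k c)))} {E : ∀ c, Finset (C.Index (k c))}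
    {v : ∀ c, Fin (C.n (k c))} (hv : ∀ c, v c ∈ U c)
    (hU : ∀ᶠ c in l, (U c).card ≤ s) (hE : ∀ᶠ c in l, (E c).card ≤ s)
    {ψ : ∀ c, Finset (C.Index (k c)) → C.Outcome (k c) → ℝ} (hψ : ∀ c, IsTest C (v c) (ψ c))
    {y : ℝ} (hy : ∀ j : ℕ, ∀ ε > 0, ∀ᶠ c in l, ∀ T : Finset (C.Index (k c)), T.card = j →
      |C.avg (k c) (ψ c (E c ∪ T)) - y| ≤ ε) :
    Tendsto (fun c => C.avg (k c) (fun ω => ψ c (E c) ω *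
      (if C.g ≤ (C.usables ω (U c) (E c) t (v c)).card then 1 else 0))) l
      (𝓝 (y * C.limit (t + 1))) := by
  have hpt : ∀ j : ℕ, Tendsto (fun c => C.avg (k c) (fun ω => ψ c (E c) ω *
      (if (C.usables ω (U c) (E c) t (v c)).card = j then 1 else 0))) l
      (𝓝 (y * (Real.exp (-C.rate t) * (C.rate t ^ j / j.factorial)))) := by
    intro j
    have h1 := tendsto_of_binomial_moments (l := l)
      (b := fun c i => C.avg (k c)
        (fun ω => ψ c (E c) ω * ((C.usables ω (U c) (E c) t (v c)).card.choose i : ℕ)))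
      (B := (C.r + C.β + 1) * C.bound) (y := y) (s := C.rate t) (by
        filter_upwards [hk.eventually C.eventually_natDegree_lt,
          hk.eventually C.eventually_card_index_le] with c hkc hLc i
        rw [abs_of_nonneg (avg_mul_choose_nonneg (hψ c) _ _ _)]
        exact avg_mul_choose_le (hψ c) hkc hLc (hv c) _ _)
      (tendsto_avg_mul_choose hC hk hv hU hE hψ hy) j
    refine h1.congr fun c => ?_
    have hle : ∀ ω : C.Outcome (k c), (C.usables ω (U c) (E c) t (v c)).card ≤
        Fintype.card (C.Index (k c)) := fun ω => Finset.card_le_univ _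
    -- The series is finite: no more items are usable than exist.
    rw [tsum_eq_sum (s := Finset.range (Fintype.card (C.Index (k c)) + 1))]
    · simp only [avg, ← prodExpect_mul_left]
      rw [← prodExpect_sum]
      congr 1; ext ω
      rw [← sum_neg_one_pow_choose_mul_choose j _ _ (hle ω), Finset.mul_sum]
      exact Finset.sum_congr rfl fun i _ => by ring
    · intro i hi
      have hi' : Fintype.card (C.Index (k c)) < i := by simpa using hi
      have : ∀ ω : C.Outcome (k c), (C.usables ω (U c) (E c) t (v c)).card.choose i = 0 :=
        fun ω => Nat.choose_eq_zero_of_lt ((hle ω).trans_lt hi')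
      simp only [this, avg, Nat.cast_zero, mul_zero]
      simp [prodExpect]
  have hy0 : Tendsto (fun c => C.avg (k c) (ψ c (E c))) l (𝓝 y) := by
    rw [tendsto_iff_eventually_abs_sub_le]
    intro ε hε
    exact (hy 0 ε hε).mono fun c hc => by simpa using hc ∅ rfl
  have h2 := hy0.sub (tendsto_finsetSum (Finset.range C.g) fun j _ => hpt j)
  have h3 : C.limit (t + 1) = poissonTail C.g (C.rate t) := rfl
  rw [h3, poissonTail, mul_sub, mul_one, Finset.mul_sum]
  refine h2.congr fun c => ?_
  simp only [avg]
  rw [← prodExpect_sum, ← prodExpect_sub]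
  congr 1; ext ω
  rw [← Finset.mul_sum, Finset.sum_ite_eq, ← mul_one_sub]
  congr 1
  simp only [Finset.mem_range]
  split_ifs <;> first | omega | simp

lemma isTest_const_one {k : ℕ} (v : Fin (C.n k)) : IsTest C v fun _ _ => 1 :=
  ⟨fun _ _ => zero_le_one, fun _ _ => le_rfl, fun _ _ _ _ => rfl, fun _ _ _ _ _ => rfl⟩

/-- With `v` frozen, items at `v` are inert and do not affect the density. This functional drives
the second moment computation. -/
lemma isTest_density {k : ℕ} {v : Fin (C.n k)} {U : Finset (Fin (C.n k))} (hv : v ∈ U) (t : ℕ) :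
    IsTest C v fun E ω => C.density ω U E t where
  nonneg E ω := C.density_nonneg ω U E t
  le_one E ω := C.density_le_one ω U E t
  union E E' ω h := by
    have : C.peeled ω U (E ∪ E') t = C.peeled ω U E t :=
      peel_union_of_touch (fun e he => ⟨v, hv, h e he⟩) t
    simp only [density, this]
  update E e he ω y := by
    have : C.peeled (Function.update ω e y) U E t = C.peeled ω U E t :=
      peelAt_update he ω y U t
    simp only [density, this]

open Classical in
/-- The indicator of the event that at least `g` items are usable for `v` but do not span. -/
noncomputable def deficient {k : ℕ} (C : CodeFamily.{u}) (U : Finset (Fin (C.n k)))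
    (E : Finset (C.Index k)) (t : ℕ) (v : Fin (C.n k)) (ω : C.Outcome k) : ℝ :=
  if C.g ≤ (C.usables ω U E t v).card ∧
    Submodule.span (C.F k) ((fun e => itemVec (C.n k) C.g (C.m k) (C.M k) (C.F k) e (ω e) v) ''
      (C.usables ω U E t v : Set (C.Index k))) ≠ ⊤ then 1 else 0

/-- There are of order `n ^ g` sets of `g` items, each connected to `v` with probability `O(n ^
(-g))`, and dependence costs `1 / q`. Only here is the growth of the field used. -/
lemma tendsto_avg_deficient (hk : Tendsto k l atTop) (U : ∀ c, Finset (Fin (C.n (k c))))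
    (E : ∀ c, Finset (C.Index (k c))) (v : ∀ c, Fin (C.n (k c))) :
    Tendsto (fun c => C.avg (k c) (C.deficient (U c) (E c) t (v c))) l (𝓝 0) := by
  have hb := zero_le_one.trans C.one_le_bound
  set D : ℝ := ((C.r + C.β + 1) * C.bound) ^ C.g / C.g.factorial * C.g
  have hlim : Tendsto (fun c => D / (Fintype.card (C.F (k c)) : ℝ)) l (𝓝 0) :=
    (tendsto_natCast_atTop_atTop.comp (C.tendsto_card.comp hk)).const_div_atTop D
  refine squeeze_zero' (Eventually.of_forall fun c => prodExpect_nonneg (C.weight_nonneg _)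
    fun ω => by unfold deficient; split_ifs <;> simp) ?_ hlim
  filter_upwards [hk.eventually C.eventually_natDegree_lt,
    hk.eventually C.eventually_card_index_le] with c hkc hLc
  have hδ : 0 ≤ C.bound / C.n (k c) := by positivity
  have h := prodExpect_deficient_le (supp := itemSupp _ _ _ _ _) (vec := itemVec _ _ _ _ _)
    C.one_le_g (C.weight_nonneg (k c)) (C.sum_weight hkc)
    (δ := C.bound / C.n (k c)) (ε := C.bound / C.n (k c) / Fintype.card (C.F (k c)))
    (by positivity) (v := v c)
    (fun e => sum_itemWeight_supp_le C.coeff_nonneg hkc.le (by omega) e (v c))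
    (fun e H hH => sum_itemWeight_vec_le C.coeff_nonneg hkc.le (by omega) e (v c) H hH)
    (U c) (E c) t
  refine h.trans ?_
  have hg : (C.bound / C.n (k c)) ^ (C.g - 1) * (C.bound / C.n (k c)) =
      (C.bound / C.n (k c)) ^ C.g := by
    rw [← pow_succ, Nat.sub_add_cancel C.one_le_g]
  calc ((Fintype.card (C.Index (k c))).choose C.g : ℝ) * (C.g * ((C.bound / C.n (k c)) ^ (C.g - 1) *
        (C.bound / C.n (k c) / Fintype.card (C.F (k c)))))
      = ((Fintype.card (C.Index (k c))).choose C.g : ℝ) * (C.bound / C.n (k c)) ^ C.g * C.g /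
        Fintype.card (C.F (k c)) := by
        rw [← hg]; ring
    _ ≤ _ := by
        refine div_le_div_of_nonneg_right (mul_le_mul_of_nonneg_right
          ((choose_mul_div_pow_le hb).trans ?_) (by positivity)) (by positivity)
        gcongr

open Classical in
/-- The indicator of the event that `v` is peeled. -/
noncomputable def peeledInd {k : ℕ} (C : CodeFamily.{u}) (V : Finset (Fin (C.n k)))
    (E : Finset (C.Index k)) (t : ℕ) (v : Fin (C.n k)) (ω : C.Outcome k) : ℝ :=
  if v ∈ C.peeled ω V E t then 1 else 0

lemma peeledInd_nonneg {k : ℕ} (V : Finset (Fin (C.n k))) (E : Finset (C.Index k)) (t : ℕ)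
    (v : Fin (C.n k)) (ω : C.Outcome k) : 0 ≤ C.peeledInd V E t v ω := by
  unfold peeledInd; split_ifs <;> simp

lemma peeledInd_le_one {k : ℕ} (V : Finset (Fin (C.n k))) (E : Finset (C.Index k)) (t : ℕ)
    (v : Fin (C.n k)) (ω : C.Outcome k) : C.peeledInd V E t v ω ≤ 1 := by
  unfold peeledInd; split_ifs <;> simp

lemma density_eq_sum {k : ℕ} (ω : C.Outcome k) (V : Finset (Fin (C.n k)))
    (E : Finset (C.Index k)) (t : ℕ) :
    C.density ω V E t = (∑ v, C.peeledInd V E t v ω) / C.n k := by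
  classical
  simp only [peeledInd]
  rw [Finset.sum_boole]
  simp [density]

/-- Spanning requires at least `g` usable items, so the two indicators differ only when enough items
fail to span. -/
lemma abs_peeledInd_sub_le {k : ℕ} {V : Finset (Fin (C.n k))} (E : Finset (C.Index k)) (t : ℕ)
    {v : Fin (C.n k)} (hv : v ∉ V) (ω : C.Outcome k) :
    |C.peeledInd V E (t + 1) v ω -
      (if C.g ≤ (C.usables ω (insert v V) E t v).card then 1 else 0)| ≤
      C.deficient (insert v V) E t v ω := by
  have h : v ∈ C.peeled ω V E (t + 1) ↔ Submodule.span (C.F k)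
      ((fun e => itemVec (C.n k) C.g (C.m k) (C.M k) (C.F k) e (ω e) v) ''
      (C.usables ω (insert v V) E t v : Set (C.Index k))) = ⊤ := mem_peel_succ_iff_cavity hv
  have h' : v ∈ C.peeled ω V E (t + 1) → C.g ≤ (C.usables ω (insert v V) E t v).card :=
    fun h1 => le_card_of_span_eq_top (h.1 h1)
  unfold peeledInd deficient
  by_cases h1 : v ∈ C.peeled ω V E (t + 1)
  · simp [h1, h' h1, h.1 h1]
  · by_cases h2 : C.g ≤ (C.usables ω (insert v V) E t v).card
    · simp [h1, h2, mt h.2 h1]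
    · simp [h1, h2]

/-- The probability that a given generation is peeled, also in the presence of a test functional. -/
lemma tendsto_avg_mul_peeledInd (hC : C.Concentrated t) (hk : Tendsto k l atTop) {s : ℕ}
    {V : ∀ c, Finset (Fin (C.n (k c)))} {E : ∀ c, Finset (C.Index (k c))}
    {v : ∀ c, Fin (C.n (k c))} (hv : ∀ᶠ c in l, v c ∉ V c)
    (hV : ∀ᶠ c in l, (V c).card ≤ s) (hE : ∀ᶠ c in l, (E c).card ≤ s)
    {ψ : ∀ c, Finset (C.Index (k c)) → C.Outcome (k c) → ℝ} (hψ : ∀ c, IsTest C (v c) (ψ c))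
    {y : ℝ} (hy : ∀ j : ℕ, ∀ ε > 0, ∀ᶠ c in l, ∀ T : Finset (C.Index (k c)), T.card = j →
      |C.avg (k c) (ψ c (E c ∪ T)) - y| ≤ ε) :
    Tendsto (fun c => C.avg (k c) (fun ω => ψ c (E c) ω * C.peeledInd (V c) (E c) (t + 1) (v c) ω))
      l (𝓝 (y * C.limit (t + 1))) := by
  have h1 := tendsto_avg_mul_ite hC hk (s := s + 1) (U := fun c => insert (v c) (V c)) (E := E)
    (v := v) (fun c => Finset.mem_insert_self _ _)
    (hV.mono fun c hc => (Finset.card_insert_le _ _).trans (by omega))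
    (hE.mono fun c hc => by omega) hψ hy
  suffices h : Tendsto (fun c =>
      C.avg (k c) (fun ω => ψ c (E c) ω * C.peeledInd (V c) (E c) (t + 1) (v c) ω) -
      C.avg (k c) (fun ω => ψ c (E c) ω *
        (if C.g ≤ (C.usables ω (insert (v c) (V c)) (E c) t (v c)).card then 1 else 0))) l
      (𝓝 0) by simpa using h.add h1
  refine squeeze_zero_norm' (hv.mono fun c hc => ?_)
    (tendsto_avg_deficient (C := C) (t := t) hk (fun c => insert (v c) (V c)) E v)
  rw [Real.norm_eq_abs, avg, avg, ← prodExpect_sub]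
  refine (abs_prodExpect_le (C.weight_nonneg _) _).trans
    (prodExpect_mono (C.weight_nonneg _) fun ω => ?_)
  rw [← mul_sub, abs_mul, abs_of_nonneg ((hψ c).nonneg _ _)]
  exact (mul_le_of_le_one_left (abs_nonneg _) ((hψ c).le_one _ _)).trans
    (abs_peeledInd_sub_le (E c) t hc ω)

/-! ### First two moments of the density, and concentration -/

/-- An average over all generations of quantities that converge uniformly off a bounded set. -/
lemma tendsto_sum_div (hk : Tendsto k l atTop) {s : ℕ} {V : ∀ c, Finset (Fin (C.n (k c)))}
    (hV : ∀ᶠ c in l, (V c).card ≤ s) {f : ∀ c, Fin (C.n (k c)) → ℝ} {y : ℝ}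
    (hf0 : ∀ᶠ c in l, ∀ v, 0 ≤ f c v) (hf1 : ∀ᶠ c in l, ∀ v, f c v ≤ 1)
    (hf : Tendsto (fun x : Σ c, Fin (C.n (k c)) => f x.1 x.2) (sigmaFilter l fun c v => v ∉ V c)
      (𝓝 y)) : Tendsto (fun c => (∑ v, f c v) / C.n (k c)) l (𝓝 y) := by
  have h1 : Tendsto (fun c => s * (1 + |y|) / C.n (k c)) l (𝓝 0) :=
    (C.tendsto_cast_n.comp hk).const_div_atTop _
  rw [tendsto_iff_eventually_abs_sub_le] at h1 ⊢
  intro ε hε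
  filter_upwards [h1 (ε / 2) (by positivity), tendsto_sigmaFilter.1 hf (ε / 2) (by positivity), hV,
    hf0, hf1, hk.eventually C.eventually_natDegree_lt] with c hc1 hc2 hVc h0 h1 hkc
  have hn : (0 : ℝ) < C.n (k c) := by exact_mod_cast (by omega : 0 < C.n (k c))
  rw [sub_zero, abs_of_nonneg (by positivity)] at hc1
  -- The exceptional generations contribute at most `s (1 + |y|) / n`, the others are uniformly
  -- close to `y`.
  have hsplit : (∑ v, f c v) / C.n (k c) - y =
      (∑ v ∈ V c, (f c v - y)) / C.n (k c) + (∑ v ∈ (V c)ᶜ, (f c v - y)) / C.n (k c) := by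
    rw [← add_div, Finset.sum_add_sum_compl, Finset.sum_sub_distrib]
    simp only [Finset.sum_const, Finset.card_univ, Fintype.card_fin, nsmul_eq_mul]
    field_simp
  have hA : |(∑ v ∈ V c, (f c v - y)) / C.n (k c)| ≤ ε / 2 := by
    refine le_trans ?_ hc1
    rw [abs_div, abs_of_pos hn]
    refine div_le_div_of_nonneg_right ?_ hn.le
    refine (Finset.abs_sum_le_sum_abs _ _).trans ((Finset.sum_le_card_nsmul _ _ (1 + |y|)
      fun v _ => ?_).trans ?_)
    · refine (abs_sub _ _).trans ?_
      rw [abs_of_nonneg (h0 v)]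
      linarith [h1 v]
    · rw [nsmul_eq_mul]
      gcongr
  have hB : |(∑ v ∈ (V c)ᶜ, (f c v - y)) / C.n (k c)| ≤ ε / 2 := by
    rw [abs_div, abs_of_pos hn, div_le_iff₀ hn]
    refine (Finset.abs_sum_le_sum_abs _ _).trans ((Finset.sum_le_card_nsmul _ _ (ε / 2)
      fun v hv => hc2 v (by simpa using hv)).trans ?_)
    rw [nsmul_eq_mul, mul_comm]
    refine mul_le_mul_of_nonneg_left ?_ (by positivity)
    exact_mod_cast (Finset.card_le_univ _).trans_eq (Fintype.card_fin _)
  rw [hsplit]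
  exact (abs_add_le _ _).trans (by linarith)

lemma tendsto_avg_density (hC : C.Concentrated t) (hk : Tendsto k l atTop) {s : ℕ}
    {V : ∀ c, Finset (Fin (C.n (k c)))} {E : ∀ c, Finset (C.Index (k c))}
    (hV : ∀ᶠ c in l, (V c).card ≤ s) (hE : ∀ᶠ c in l, (E c).card ≤ s) :
    Tendsto (fun c => C.avg (k c) (fun ω => C.density ω (V c) (E c) (t + 1))) l
      (𝓝 (C.limit (t + 1))) := by
  have hgood := hk.eventually C.eventually_natDegree_lt
  have h1 : Tendsto (fun x : Σ c, Fin (C.n (k c)) =>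
      C.avg (k x.1) (C.peeledInd (V x.1) (E x.1) (t + 1) x.2)) (sigmaFilter l fun c v => v ∉ V c)
      (𝓝 (C.limit (t + 1))) := by
    have := tendsto_avg_mul_peeledInd (C := C) (t := t) (κ := Σ c, Fin (C.n (k c)))
      (l := sigmaFilter l fun c v => v ∉ V c) (k := fun x => k x.1) (s := s)
      (V := fun x => V x.1) (E := fun x => E x.1) (v := fun x => x.2)
      (ψ := fun x _ _ => 1) (y := 1) hC (hk.comp tendsto_sigmaFilter_fst)
      (eventually_sigmaFilter.2 (Eventually.of_forall fun c v hv => hv))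
      (eventually_sigmaFilter_fst hV) (eventually_sigmaFilter_fst hE)
      (fun x => isTest_const_one x.2)
      (fun j ε hε => (eventually_sigmaFilter_fst hgood).mono fun x hx T _ => by
        rw [avg, prodExpect_const (C.sum_weight hx)]; simpa using hε.le)
    simpa using this
  have h2 := tendsto_sum_div hk hV (f := fun c v => C.avg (k c) (C.peeledInd (V c) (E c) (t + 1) v))
    (Eventually.of_forall fun c v => prodExpect_nonneg (C.weight_nonneg _)
      fun ω => peeledInd_nonneg _ _ _ _ _)
    (hgood.mono fun c hc v => prodExpect_le (C.weight_nonneg _) (C.sum_weight hc)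
      fun ω => peeledInd_le_one _ _ _ _ _) h1
  refine h2.congr fun c => ?_
  simp only [density_eq_sum, avg]
  rw [prodExpect_div, prodExpect_sum]

lemma density_anti {k : ℕ} (ω : C.Outcome k) {V V' : Finset (Fin (C.n k))} (h : V ⊆ V')
    (E : Finset (C.Index k)) (t : ℕ) : C.density ω V' E t ≤ C.density ω V E t := by
  refine div_le_div_of_nonneg_right ?_ (by positivity)
  exact_mod_cast Finset.card_le_card (peel_subset h subset_rfl t)

/-- The squared density is the average over `v` of the density times the indicator that `v` is
peeled. In such a term the density is replaced by that of the process frozen at `v`, which is a test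
functional. Freezing only lowers the density and both have the same limiting mean, so the
replacement is negligible in mean. -/
lemma tendsto_avg_density_sq (hC : C.Concentrated t) (hk : Tendsto k l atTop) {s : ℕ}
    {V : ∀ c, Finset (Fin (C.n (k c)))} {E : ∀ c, Finset (C.Index (k c))}
    (hV : ∀ᶠ c in l, (V c).card ≤ s) (hE : ∀ᶠ c in l, (E c).card ≤ s) :
    Tendsto (fun c => C.avg (k c) (fun ω => C.density ω (V c) (E c) (t + 1) ^ 2)) l
      (𝓝 (C.limit (t + 1) ^ 2)) := by
  have hgood := hk.eventually C.eventually_natDegree_lt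
  have hk' : Tendsto (fun x : Σ c, Fin (C.n (k c)) => k x.1)
    (sigmaFilter l fun c v => v ∉ V c) atTop := hk.comp tendsto_sigmaFilter_fst
  have hV' : ∀ᶠ x : Σ c, Fin (C.n (k c)) in sigmaFilter l fun c v => v ∉ V c,
      (insert x.2 (V x.1)).card ≤ s + 1 :=
    (eventually_sigmaFilter_fst hV).mono fun x hx => (Finset.card_insert_le _ _).trans (by omega)
  have hE' : ∀ᶠ x : Σ c, Fin (C.n (k c)) in sigmaFilter l fun c v => v ∉ V c,
      (E x.1).card ≤ s + 1 :=
    (eventually_sigmaFilter_fst hE).mono fun x hx => by omega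
  have h0 : Tendsto (fun x : Σ c, Fin (C.n (k c)) => C.avg (k x.1) (fun ω =>
      C.density ω (insert x.2 (V x.1)) (E x.1) (t + 1) *
        C.peeledInd (V x.1) (E x.1) (t + 1) x.2 ω)) (sigmaFilter l fun c v => v ∉ V c)
      (𝓝 (C.limit (t + 1) * C.limit (t + 1))) := by
    refine tendsto_avg_mul_peeledInd (C := C) (t := t) (κ := Σ c, Fin (C.n (k c)))
      (l := sigmaFilter l fun c v => v ∉ V c) (k := fun x => k x.1) (s := s)
      (V := fun x => V x.1) (E := fun x => E x.1) (v := fun x => x.2)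
      (ψ := fun x E' ω => C.density ω (insert x.2 (V x.1)) E' (t + 1)) hC hk'
      (eventually_sigmaFilter.2 (Eventually.of_forall fun c v hv => hv))
      (eventually_sigmaFilter_fst hV) (eventually_sigmaFilter_fst hE)
      (fun x => isTest_density (Finset.mem_insert_self _ _) _) (fun j => ?_)
    -- The mean of the test functional has to converge uniformly over the further removed sets `T`
    -- as well, hence a second layer of indices and the size bound `s + 1 + j`.
    refine tendsto_sigmaFilter.1 (tendsto_avg_density (C := C) (t := t)
      (κ := Σ x : (Σ c, Fin (C.n (k c))), Finset (C.Index (k x.1)))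
      (l := sigmaFilter (sigmaFilter l fun c v => v ∉ V c) fun _ T => T.card = j)
      (k := fun x => k x.1.1) (s := s + 1 + j)
      (V := fun x => insert x.1.2 (V x.1.1)) (E := fun x => E x.1.1 ∪ x.2) hC
      (hk'.comp tendsto_sigmaFilter_fst)
      (eventually_sigmaFilter_fst (hV'.mono fun x hx => hx.trans (by omega)))
      (eventually_sigmaFilter.2 (hE'.mono fun x hx T hT =>
        (Finset.card_union_le _ _).trans (by simp only; omega))))
  have hd1 : Tendsto (fun x : Σ c, Fin (C.n (k c)) => C.avg (k x.1) (fun ω =>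
      C.density ω (V x.1) (E x.1) (t + 1))) (sigmaFilter l fun c v => v ∉ V c)
      (𝓝 (C.limit (t + 1))) :=
    (tendsto_avg_density hC hk hV hE).comp tendsto_sigmaFilter_fst
  have hd2 : Tendsto (fun x : Σ c, Fin (C.n (k c)) => C.avg (k x.1) (fun ω =>
      C.density ω (insert x.2 (V x.1)) (E x.1) (t + 1))) (sigmaFilter l fun c v => v ∉ V c)
      (𝓝 (C.limit (t + 1))) := tendsto_avg_density hC hk' hV' hE'
  have h1 : Tendsto (fun x : Σ c, Fin (C.n (k c)) => C.avg (k x.1) (fun ω =>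
      C.density ω (V x.1) (E x.1) (t + 1) * C.peeledInd (V x.1) (E x.1) (t + 1) x.2 ω))
      (sigmaFilter l fun c v => v ∉ V c) (𝓝 (C.limit (t + 1) ^ 2)) := by
    have hd : Tendsto (fun x : Σ c, Fin (C.n (k c)) => C.avg (k x.1) (fun ω =>
        C.density ω (V x.1) (E x.1) (t + 1) * C.peeledInd (V x.1) (E x.1) (t + 1) x.2 ω) -
        C.avg (k x.1) (fun ω => C.density ω (insert x.2 (V x.1)) (E x.1) (t + 1) *
          C.peeledInd (V x.1) (E x.1) (t + 1) x.2 ω))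
        (sigmaFilter l fun c v => v ∉ V c) (𝓝 0) := by
      have hd3 := hd1.sub hd2
      rw [sub_self] at hd3
      refine squeeze_zero (fun x => ?_) (fun x => ?_) hd3
      · rw [avg, avg, ← prodExpect_sub]
        refine prodExpect_nonneg (C.weight_nonneg _) fun ω => ?_
        rw [← sub_mul]
        exact mul_nonneg (sub_nonneg.2 (density_anti ω (Finset.subset_insert _ _) _ _))
          (peeledInd_nonneg _ _ _ _ _)
      · rw [avg, avg, avg, avg, ← prodExpect_sub, ← prodExpect_sub]
        refine prodExpect_mono (C.weight_nonneg _) fun ω => ?_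
        rw [← sub_mul]
        exact mul_le_of_le_one_right
          (sub_nonneg.2 (density_anti ω (Finset.subset_insert _ _) _ _))
          (peeledInd_le_one _ _ _ _ _)
    simpa [sq] using hd.add h0
  have h2 := tendsto_sum_div hk hV (f := fun c v => C.avg (k c) fun ω =>
      C.density ω (V c) (E c) (t + 1) * C.peeledInd (V c) (E c) (t + 1) v ω)
    (Eventually.of_forall fun c v => prodExpect_nonneg (C.weight_nonneg _)
      fun ω => mul_nonneg (C.density_nonneg _ _ _ _) (peeledInd_nonneg _ _ _ _ _))
    (hgood.mono fun c hc v => prodExpect_le (C.weight_nonneg _) (C.sum_weight hc)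
      fun ω => mul_le_one₀ (C.density_le_one _ _ _ _) (peeledInd_nonneg _ _ _ _ _)
        (peeledInd_le_one _ _ _ _ _)) h1
  refine h2.congr fun c => ?_
  simp only [avg]
  rw [← prodExpect_sum, ← prodExpect_div]
  congr 1; ext ω
  rw [← Finset.mul_sum, mul_div_assoc, ← density_eq_sum, sq]

/-- Both moments in round `t + 1` need only concentration in round `t`; the mean deviation is
bounded by the root of the mean squared deviation. -/
theorem concentrated (C : CodeFamily.{u}) (t : ℕ) : C.Concentrated t := by
  induction t with
  | zero =>
    intro κ l k hk s V E hV hE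
    refine tendsto_const_nhds.congr fun c => ?_
    simp [density, peeled, peelAt, peel, limit, avg, prodExpect]
  | succ t ih =>
    intro κ l k hk s V E hV hE
    have h1 := tendsto_avg_density ih hk hV hE
    have h2 := tendsto_avg_density_sq ih hk hV hE
    set x := C.limit (t + 1)
    have h3 : Tendsto (fun c => √(C.avg (k c) (fun ω => C.density ω (V c) (E c) (t + 1) ^ 2) -
        2 * x * C.avg (k c) (fun ω => C.density ω (V c) (E c) (t + 1)) + x ^ 2)) l (𝓝 0) := by
      have := ((h2.sub (h1.const_mul (2 * x))).add_const (x ^ 2)).sqrt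
      convert this using 2
      rw [show x ^ 2 - 2 * x * x + x ^ 2 = 0 by ring, Real.sqrt_zero]
    refine squeeze_zero' (Eventually.of_forall fun c => prodExpect_nonneg (C.weight_nonneg _)
      fun ω => abs_nonneg _) ?_ h3
    filter_upwards [hk.eventually C.eventually_natDegree_lt] with c hkc
    refine Real.le_sqrt_of_sq_le ((prodExpect_sq_le (C.weight_nonneg _)
      (C.sum_weight hkc) _).trans_eq ?_)
    simp only [avg]
    rw [← prodExpect_mul_left, ← prodExpect_sub]
    nth_rewrite 1 [← prodExpect_const (C.sum_weight hkc) (x ^ 2)]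
    rw [← prodExpect_add]
    congr 1; ext ω
    rw [sq_abs]; ring

end CodeFamily

/-! ### The decoder as a peeling process -/

section Bridge

variable {n g m M : ℕ} {P : ℝ[X]} {F : Type*}

/-- The received packets and check equations of a family of items. -/
def toSample (ω : ∀ e, Item n g m M F e) : Sample n g m M F :=
  (fun j => ω (.inl j), fun c => ω (.inr c))

lemma expect_eq_prodExpect [Fintype F] (X : Sample n g m M F → ℝ) :
    expect n g m M P F X = prodExpect (itemWeight n g m M P F) fun ω => X (toSample ω) := by
  rw [expect, prodExpect, ← (Equiv.sumPiEquivProdPi (Item n g m M F)).sum_comp]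
  refine Finset.sum_congr rfl fun ω _ => ?_
  rw [Fintype.prod_sum_type]
  rfl

/-- Outcomes containing a check of degree zero or one have weight zero. -/
lemma prodExpect_congr_of_two_le [Fintype F] (hP0 : P.coeff 0 = 0) (hP1 : P.coeff 1 = 0)
    {X X' : (∀ e, Item n g m M F e) → ℝ}
    (h : ∀ ω, (∀ c, 2 ≤ ((toSample ω).2 c).1.card) → X ω = X' ω) :
    prodExpect (itemWeight n g m M P F) X = prodExpect (itemWeight n g m M P F) X' := by
  refine Finset.sum_congr rfl fun ω _ => ?_
  by_cases hω : ∀ c, 2 ≤ ((toSample ω).2 c).1.card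
  · rw [h ω hω]
  · push Not at hω
    obtain ⟨c, hc⟩ := hω
    have h0 : itemWeight n g m M P F (.inr c) (ω (.inr c)) = 0 := by
      change checkProb n g P F ((toSample ω).2 c) = 0
      have : P.coeff ((toSample ω).2 c).1.card = 0 := by
        interval_cases ((toSample ω).2 c).1.card <;> assumption
      simp [checkProb, this]
    rw [Finset.prod_eq_zero (Finset.mem_univ (Sum.inr c : Fin m ⊕ Fin M)) h0]
    ring

variable [Field F]

/-- The decoder is the peeling process. -/
lemma fullRank_toSample (ω : ∀ e, Item n g m M F e) (hω : ∀ c, 2 ≤ ((toSample ω).2 c).1.card)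
    (i : ℕ) :
    fullRank (toSample ω) i = peelAt (itemSupp n g m M F) (itemVec n g m M F) ω ∅ ∅ (i + 1) := by
  classical
  set A := peelAt (itemSupp n g m M F) (itemVec n g m M F) ω ∅ ∅
  set W : ℕ → Fin n → Submodule F (Fin g → F) := fun i v => Submodule.span F
    ((fun e => itemVec n g m M F e (ω e) v) ''
      (usable (fun e => itemSupp n g m M F e (ω e)) ∅ (A i) v : Set (Fin m ⊕ Fin M)))
  have hA : ∀ i v, v ∈ A (i + 1) ↔ W i v = ⊤ := fun i v => mem_peel_succ.trans (by simp; rfl)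
  have hfr : ∀ i, ((∀ v, v ∉ A i → rowSpace (toSample ω) i v = W i v) ∧
      ∀ v, v ∈ A i → rowSpace (toSample ω) i v = ⊤) →
      ∀ v, v ∈ A (i + 1) ↔ rowSpace (toSample ω) i v = ⊤ := by
    intro i h v
    by_cases hv : v ∈ A i
    · simp only [h.2 v hv, iff_true]
      exact peel_subset_succ i hv
    · rw [h.1 v hv, hA]
  have hfull : ∀ i, ((∀ v, v ∉ A i → rowSpace (toSample ω) i v = W i v) ∧
      ∀ v, v ∈ A i → rowSpace (toSample ω) i v = ⊤) →
      fullRankOf (rowSpace (toSample ω) i) = A (i + 1) := by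
    intro i h
    ext v
    rw [hfr i h, fullRankOf, Finset.mem_filter, and_iff_right (Finset.mem_univ _)]
    constructor
    · intro hv
      exact Submodule.eq_top_of_finrank_eq (by rw [hv, Module.finrank_fin_fun])
    · intro hv
      rw [hv, finrank_top, Module.finrank_fin_fun]
  -- Row spaces agree with the spans of usable items only off `A i`: the decoder adds no checks to a
  -- generation already deleted, but its row space is full anyway.
  have hinv : ∀ i, (∀ v, v ∉ A i → rowSpace (toSample ω) i v = W i v) ∧
      ∀ v, v ∈ A i → rowSpace (toSample ω) i v = ⊤ := by
    intro i
    induction i with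
    | zero =>
      refine ⟨fun v _ => le_antisymm ?_ ?_, fun v hv => absurd hv (by simp [A, peelAt, peel])⟩
      · refine Submodule.span_mono ?_
        rintro b ⟨j, hj⟩
        refine ⟨.inl j, ?_, ?_⟩
        · rw [Finset.mem_coe, mem_usable]
          have hj1 : ((toSample ω).1 j).1 = v := by rw [hj]
          change _ ∧ v ∈ ({((toSample ω).1 j).1} : Finset _) ∧
            ({((toSample ω).1 j).1} : Finset _) \ {v} ⊆ A 0
          simp [hj1]
        · change ((toSample ω).1 j).2 = b
          rw [hj]
      · refine Submodule.span_mono ?_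
        rintro _ ⟨e, he, rfl⟩
        rw [Finset.mem_coe, mem_usable] at he
        rcases e with j | c
        · refine ⟨j, ?_⟩
          have : v ∈ ({((toSample ω).1 j).1} : Finset _) := he.2.1
          rw [Finset.mem_singleton] at this
          exact Prod.ext this.symm rfl
        -- A check usable while nothing is peeled would have its support inside `{v}`, against
        -- degree at least two.
        · exfalso
          have h1 : ((toSample ω).2 c).1 \ {v} ⊆ ∅ := he.2.2
          have h2 := Finset.card_le_card (Finset.sdiff_eq_empty_iff_subset.1
            (Finset.subset_empty.1 h1))
          have := hω c
          simp at h2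
          omega
    | succ i ih =>
      have hfr' := hfull i ih
      have hsucc : ∀ v, rowSpace (toSample ω) (i + 1) v = rowSpace (toSample ω) i v ⊔
          Submodule.span F {a | ∃ c, ((toSample ω).2 c).1 \ A (i + 1) = {v} ∧
            a = ((toSample ω).2 c).2 v} := by
        intro v
        rw [← hfr']; rfl
      constructor
      · intro v hv
        have hv' : v ∉ A i := fun h => hv (peel_subset_succ i h)
        rw [hsucc, ih.1 v hv']
        -- As `v` is not deleted, having `v` as the only remaining generation is the same as being
        -- usable for `v`.
        have hiff : ∀ S : Finset (Fin n), S \ A (i + 1) = {v} ↔ v ∈ S ∧ S \ {v} ⊆ A (i + 1) := by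
          intro S
          constructor
          · intro h
            have hmem : ∀ x, x ∈ S ∧ x ∉ A (i + 1) ↔ x = v := fun x => by
              rw [← Finset.mem_sdiff, h, Finset.mem_singleton]
            refine ⟨((hmem v).2 rfl).1, fun x hx => ?_⟩
            rw [Finset.mem_sdiff, Finset.mem_singleton] at hx
            by_contra hxA
            exact hx.2 ((hmem x).1 ⟨hx.1, hxA⟩)
          · rintro ⟨h1, h2⟩
            ext x
            rw [Finset.mem_sdiff, Finset.mem_singleton]
            constructor
            · rintro ⟨hx, hxA⟩
              by_contra hxv
              exact hxA (h2 (by simp [hx, hxv]))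
            · rintro rfl
              exact ⟨h1, hv⟩
        refine le_antisymm (sup_le ?_ (Submodule.span_mono ?_)) (Submodule.span_le.2 ?_)
        · exact Submodule.span_mono (Set.image_mono (Finset.coe_subset.2
            (usable_subset (peel_subset_succ i) subset_rfl)))
        · rintro _ ⟨c, hc, rfl⟩
          refine ⟨.inr c, ?_, rfl⟩
          rw [Finset.mem_coe, mem_usable]
          exact ⟨by simp, (hiff _).1 hc⟩
        · rintro _ ⟨e, he, rfl⟩
          rw [Finset.mem_coe, mem_usable] at he
          rcases e with j | c
          · refine Submodule.mem_sup_left (Submodule.subset_span ⟨.inl j, ?_, rfl⟩)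
            rw [Finset.mem_coe, mem_usable]
            refine ⟨by simp, he.2.1, ?_⟩
            have : v ∈ ({((toSample ω).1 j).1} : Finset _) := he.2.1
            rw [Finset.mem_singleton] at this
            change ({((toSample ω).1 j).1} : Finset _) \ {v} ⊆ A i
            simp [this]
          · exact Submodule.mem_sup_right (Submodule.subset_span ⟨c, (hiff _).2 he.2, rfl⟩)
      · intro v hv
        rw [hsucc, (hfr i ih v).1 hv, top_sup_eq]
  exact hfull i (hinv i)

/-- The indicator of a set being reduced to one element by removing `B'` but not by removing `B`. -/
lemma sum_sub_eq_ite {S B B' : Finset (Fin n)} (hB : B ⊆ B') :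
    ∑ u ∈ B'ᶜ, ((if u ∈ S ∧ S \ {u} ⊆ B' then (1 : ℝ) else 0) -
      if u ∈ S ∧ S \ {u} ⊆ B then 1 else 0) =
      if (S \ B').card = 1 ∧ (S \ B).card ≠ 1 then 1 else 0 := by
  have key : ∀ B u, u ∉ B → (u ∈ S ∧ S \ {u} ⊆ B ↔ S \ B = {u}) := by
    intro B u hu
    constructor
    · rintro ⟨h1, h2⟩
      ext x
      rw [Finset.mem_sdiff, Finset.mem_singleton]
      constructor
      · rintro ⟨hx, hxB⟩
        by_contra hxu
        exact hxB (h2 (by simp [hx, hxu]))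
      · rintro rfl
        exact ⟨h1, hu⟩
    · intro h
      have hmem : ∀ x, x ∈ S ∧ x ∉ B ↔ x = u := fun x => by
        rw [← Finset.mem_sdiff, h, Finset.mem_singleton]
      refine ⟨((hmem u).2 rfl).1, fun x hx => ?_⟩
      rw [Finset.mem_sdiff, Finset.mem_singleton] at hx
      by_contra hxB
      exact hx.2 ((hmem x).1 ⟨hx.1, hxB⟩)
  have h1 : ∀ u ∈ B'ᶜ, ((if u ∈ S ∧ S \ {u} ⊆ B' then (1 : ℝ) else 0) -
      if u ∈ S ∧ S \ {u} ⊆ B then 1 else 0) =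
      (if S \ B' = {u} then 1 else 0) - if S \ B = {u} then 1 else 0 := by
    intro u hu
    rw [Finset.mem_compl] at hu
    simp only [key B' u hu, key B u (fun h => hu (hB h))]
  rw [Finset.sum_congr rfl h1]
  have hsub : S \ B' ⊆ S \ B := Finset.sdiff_subset_sdiff subset_rfl hB
  by_cases h' : (S \ B').card = 1
  · obtain ⟨u, hu⟩ := Finset.card_eq_one.1 h'
    have huB : u ∈ S \ B := hsub (by simp [hu])
    have huB' : u ∈ B'ᶜ := by
      have : u ∈ S \ B' := by simp [hu]
      simp only [Finset.mem_sdiff] at this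
      simpa using this.2
    rw [Finset.sum_eq_single_of_mem u huB']
    · have h2 : S \ B = {u} ↔ (S \ B).card = 1 := by
        constructor
        · intro h; rw [h, Finset.card_singleton]
        · intro h
          obtain ⟨x, hx⟩ := Finset.card_eq_one.1 h
          rw [hx, Finset.mem_singleton] at huB
          rw [hx, huB]
      simp only [hu, h2, if_true, Finset.card_singleton, true_and]
      by_cases h3 : (S \ B).card = 1 <;> simp [h3]
    · intro x _ hx
      have h2 : S \ B ≠ {x} := by
        intro h; rw [h, Finset.mem_singleton] at huB; exact hx huB.symm
      have h3 : S \ B' ≠ {x} := by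
        rw [hu]; intro h; exact hx (Finset.singleton_injective h).symm
      simp [h2, h3]
  -- If `S \ B = {u}` with `u` outside `B'`, then `S \ B' = {u}` too; so here every term is zero.
  · rw [if_neg (by tauto)]
    refine Finset.sum_eq_zero fun u hu => ?_
    have h2 : S \ B' ≠ {u} := fun h => h' (by rw [h, Finset.card_singleton])
    have h3 : S \ B ≠ {u} := by
      intro h
      rw [h] at hsub
      rcases Finset.subset_singleton_iff.1 hsub with h4 | h4
      · rw [Finset.mem_compl] at hu
        have hu' : u ∈ S \ B := by simp [h]
        rw [Finset.mem_sdiff] at hu'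
        have : u ∈ S \ B' := Finset.mem_sdiff.2 ⟨hu'.1, hu⟩
        rw [h4] at this
        simp at this
      · exact h2 h4
    simp [h2, h3]

end Bridge

/-! ### Asymptotics of the checks newly reduced to degree one -/

namespace CodeFamily

variable {C : CodeFamily.{u}}

lemma avgFullRank_eq (hP0 : C.P.coeff 0 = 0) (hP1 : C.P.coeff 1 = 0) (k i : ℕ) :
    avgFullRank (C.n k) C.g (C.m k) (C.M k) C.P (C.F k) i =
      C.avg k fun ω => C.density ω ∅ ∅ (i + 1) := by
  rw [avgFullRank, expect_eq_prodExpect]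
  refine prodExpect_congr_of_two_le hP0 hP1 fun ω hω => ?_
  rw [fullRank_toSample ω hω]
  rfl

lemma tendsto_avgFullRank (hP0 : C.P.coeff 0 = 0) (hP1 : C.P.coeff 1 = 0) (i : ℕ) :
    Tendsto (fun k => avgFullRank (C.n k) C.g (C.m k) (C.M k) C.P (C.F k) i) atTop
      (𝓝 (C.limit (i + 1))) := by
  simp only [avgFullRank_eq hP0 hP1]
  exact tendsto_avg_density (s := 0) (C.concentrated i) tendsto_id
    (Eventually.of_forall fun _ => by simp) (Eventually.of_forall fun _ => by simp)

lemma peeled_subset_succ {k : ℕ} (ω : C.Outcome k) (V : Finset (Fin (C.n k)))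
    (E : Finset (C.Index k)) (t : ℕ) : C.peeled ω V E t ⊆ C.peeled ω V E (t + 1) :=
  peel_subset_succ t

/-- The expected contribution of the check equation `c` to the `i`-th reduction. -/
noncomputable def gain {k : ℕ} (C : CodeFamily.{u}) (i : ℕ) (c : Fin (C.M k)) (ω : C.Outcome k) :
    ℝ :=
  (1 - C.density ω ∅ {.inr c} (i + 1)) *
    (C.n k * usableProb (C.n k) C.P (C.peeled ω ∅ {.inr c} (i + 1)).card -
      C.n k * usableProb (C.n k) C.P (C.peeled ω ∅ {.inr c} i).card)

/-- The event for `c` is expressed in the process without `c`, as a sum over the possible remaining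
generation. That process is independent of `c`, and the terms are equal for all unpeeled
generations, which yields the factor `1 - density`. -/
lemma avgNewDegreeOne_eq (hP0 : C.P.coeff 0 = 0) (hP1 : C.P.coeff 1 = 0) {k : ℕ}
    (hk : C.P.natDegree < C.n k) (i : ℕ) :
    avgNewDegreeOne (C.n k) C.g (C.m k) (C.M k) C.P (C.F k) i =
      ∑ c, C.avg k (C.gain i c) := by
  classical
  have hn : (C.n k : ℝ) ≠ 0 := by exact_mod_cast (by omega : C.n k ≠ 0)
  set S : ∀ (c : Fin (C.M k)), C.Outcome k → Finset (Fin (C.n k)) := fun c ω =>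
    itemSupp (C.n k) C.g (C.m k) (C.M k) (C.F k) (.inr c) (ω (.inr c))
  have h1 : avgNewDegreeOne (C.n k) C.g (C.m k) (C.M k) C.P (C.F k) i =
      C.avg k fun ω => ∑ c, ∑ u ∈ (C.peeled ω ∅ {.inr c} (i + 1))ᶜ,
        ((if u ∈ S c ω ∧ S c ω \ {u} ⊆ C.peeled ω ∅ {.inr c} (i + 1) then (1 : ℝ) else 0) -
          if u ∈ S c ω ∧ S c ω \ {u} ⊆ C.peeled ω ∅ {.inr c} i then 1 else 0) := by
    rw [avgNewDegreeOne, expect_eq_prodExpect]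
    refine prodExpect_congr_of_two_le hP0 hP1 fun ω hω => ?_
    rw [newDegreeOne, ← Finset.sum_boole]
    refine Finset.sum_congr rfl fun c _ => ?_
    rw [sum_sub_eq_ite (peeled_subset_succ ω _ _ i)]
    simp only [residualDegree, fullRank_toSample ω hω]
    exact if_congr (newly_degree_one_iff (c := (Sum.inr c : C.Index k)) (hω c) i) rfl rfl
  rw [h1, avg, prodExpect_sum]
  refine Finset.sum_congr rfl fun c _ => ?_
  rw [prodExpect_resample (C.sum_weight hk) (.inr c)]
  simp only [avg]
  congr 1; ext ω
  have h2 : ∀ y j, C.peeled (Function.update ω (.inr c) y) ∅ {.inr c} j =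
      C.peeled ω ∅ {.inr c} j := fun y j => peelAt_update (by simp) ω y ∅ j
  simp only [h2, S, Function.update_self, Finset.mul_sum]
  rw [Finset.sum_comm]
  have h3 : ∀ u ∈ (C.peeled ω ∅ {.inr c} (i + 1))ᶜ, ∑ y, itemWeight (C.n k) C.g (C.m k) (C.M k) C.P
      (C.F k) (.inr c) y * ((if u ∈ itemSupp (C.n k) C.g (C.m k) (C.M k) (C.F k) (.inr c) y ∧
        itemSupp (C.n k) C.g (C.m k) (C.M k) (C.F k) (.inr c) y \ {u} ⊆
          C.peeled ω ∅ {.inr c} (i + 1) then (1 : ℝ) else 0) -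
        if u ∈ itemSupp (C.n k) C.g (C.m k) (C.M k) (C.F k) (.inr c) y ∧
        itemSupp (C.n k) C.g (C.m k) (C.M k) (C.F k) (.inr c) y \ {u} ⊆
          C.peeled ω ∅ {.inr c} i then 1 else 0) =
      usableProb (C.n k) C.P (C.peeled ω ∅ {.inr c} (i + 1)).card -
        usableProb (C.n k) C.P (C.peeled ω ∅ {.inr c} i).card := by
    intro u hu
    rw [Finset.mem_compl] at hu
    simp only [mul_sub]
    rw [Finset.sum_sub_distrib, sum_itemWeight_usable _ _ _ hu,
      sum_itemWeight_usable _ _ _ (fun h => hu (peeled_subset_succ ω _ _ i h))]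
    rfl
  rw [Finset.sum_congr rfl h3, Finset.sum_const, Finset.card_compl, nsmul_eq_mul,
    Nat.cast_sub (Finset.card_le_univ _), Fintype.card_fin, gain, density]
  field_simp

lemma abs_gain_sub_le {k : ℕ} (hk : C.P.natDegree < C.n k) (i : ℕ) (c : Fin (C.M k))
    (ω : C.Outcome k) :
    |C.gain i c ω - (1 - C.limit (i + 1)) *
      (C.P.derivative.eval (C.limit (i + 1)) - C.P.derivative.eval (C.limit i))| ≤
      (C.lip + C.bound) * |C.density ω ∅ {.inr c} (i + 1) - C.limit (i + 1)| +
        C.lip * |C.density ω ∅ {.inr c} i - C.limit i| + 2 * C.err k := by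
  have hn : (0 : ℝ) < C.n k := by exact_mod_cast (by omega : 0 < C.n k)
  have hx := C.limit_mem i
  have hx' := C.limit_mem (i + 1)
  have hL := C.lip_nonneg
  have he := C.err_nonneg hk
  set b := (C.peeled ω ∅ {.inr c} i).card
  set b' := (C.peeled ω ∅ {.inr c} (i + 1)).card
  have hbb : b ≤ b' := Finset.card_le_card (peel_subset_succ i)
  have ha0 := C.density_nonneg ω ∅ {.inr c} (i + 1)
  have ha1 := C.density_le_one ω ∅ {.inr c} (i + 1)
  set a := C.density ω ∅ {.inr c} i with ha
  set a' := C.density ω ∅ {.inr c} (i + 1) with ha'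
  set Q := C.P.derivative.eval (C.limit i)
  set Q' := C.P.derivative.eval (C.limit (i + 1))
  have hQ0 : 0 ≤ Q := C.slope_nonneg hx.1 (.inr c)
  have hQ0' : 0 ≤ Q' := C.slope_nonneg hx'.1 (.inr c)
  have hQ : Q ≤ C.bound := C.slope_le hx.1 hx.2.le (.inr c)
  have hQ' : Q' ≤ C.bound := C.slope_le hx'.1 hx'.2.le (.inr c)
  have hQQ : |Q' - Q| ≤ C.bound := abs_le.2 ⟨by linarith, by linarith⟩
  set ρ := C.n k * usableProb (C.n k) C.P b
  set ρ' := C.n k * usableProb (C.n k) C.P b'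
  have hmain : |(1 - a') * ((ρ' - ρ) - (Q' - Q))| ≤
      C.lip * |a' - C.limit (i + 1)| + C.lip * |a - C.limit i| + 2 * C.err k := by
    -- Nothing is frozen here, so all generations may be peeled. The estimates of `usableProb` do
    -- not cover this case, but then the factor `1 - a'` vanishes.
    rcases eq_or_ne b' (C.n k) with h | h
    · have : a' = 1 := by
        rw [ha', density]
        change (b' : ℝ) / _ = 1
        rw [h, div_self hn.ne']
      rw [this, sub_self, zero_mul, abs_zero]
      positivity
    · have hb' : b' < C.n k := lt_of_le_of_ne
        ((Finset.card_le_univ _).trans_eq (Fintype.card_fin _)) h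
      have h1 := C.abs_mul_usableProb_sub_derivative_le hk hb' hx'.1 hx'.2.le
      have h2 := C.abs_mul_usableProb_sub_derivative_le hk (hbb.trans_lt hb') hx.1 hx.2.le
      change |ρ' - Q'| ≤ C.lip * |a' - C.limit (i + 1)| + C.err k at h1
      change |ρ - Q| ≤ C.lip * |a - C.limit i| + C.err k at h2
      rw [abs_mul, abs_of_nonneg (by linarith : 0 ≤ 1 - a')]
      refine (mul_le_of_le_one_left (abs_nonneg _) (by linarith)).trans ?_
      rw [show ρ' - ρ - (Q' - Q) = (ρ' - Q') - (ρ - Q) by ring]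
      exact (abs_sub _ _).trans (by linarith)
  have hsplit : C.gain i c ω - (1 - C.limit (i + 1)) * (Q' - Q) =
      (1 - a') * ((ρ' - ρ) - (Q' - Q)) - (a' - C.limit (i + 1)) * (Q' - Q) := by
    change (1 - a') * (ρ' - ρ) - _ = _
    ring
  rw [hsplit]
  refine (abs_sub _ _).trans ?_
  rw [abs_mul (a' - C.limit (i + 1))]
  have := mul_le_mul_of_nonneg_left hQQ (abs_nonneg (a' - C.limit (i + 1)))
  linarith

/-- The limiting expected contribution of a check equation to the `i`-th reduction. -/
noncomputable def limitGain (C : CodeFamily.{u}) (i : ℕ) : ℝ :=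
  (1 - C.limit (i + 1)) *
    (C.P.derivative.eval (C.limit (i + 1)) - C.P.derivative.eval (C.limit i))

lemma tendsto_avg_abs_density (t : ℕ) : Tendsto (fun x : Σ k, Fin (C.M k) => C.avg x.1 fun ω =>
      |C.density ω ∅ {.inr x.2} t - C.limit t|) (sigmaFilter atTop fun _ _ => True) (𝓝 0) := by
  have hV : ∀ᶠ x : Σ k, Fin (C.M k) in sigmaFilter atTop fun _ _ => True,
      (∅ : Finset (Fin (C.n x.1))).card ≤ 1 := Eventually.of_forall fun _ => by
    rw [Finset.card_empty]; exact zero_le_one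
  have hE : ∀ᶠ x : Σ k, Fin (C.M k) in sigmaFilter atTop fun _ _ => True,
      ({.inr x.2} : Finset (C.Index x.1)).card ≤ 1 := Eventually.of_forall fun _ => by
    rw [Finset.card_singleton]
  have hk : Tendsto (fun x : Σ k, Fin (C.M k) => x.1)
    (sigmaFilter atTop fun _ _ => True) atTop := tendsto_sigmaFilter_fst
  exact C.concentrated t _ _ _ hk 1 _ _ hV hE

lemma tendsto_avg_gain (i : ℕ) :
    Tendsto (fun x : Σ k, Fin (C.M k) => C.avg x.1 (C.gain i x.2))
      (sigmaFilter atTop fun _ _ => True) (𝓝 (C.limitGain i)) := by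
  have hk' : Tendsto (Sigma.fst : (Σ k, Fin (C.M k)) → ℕ)
    (sigmaFilter atTop fun _ _ => True) atTop := tendsto_sigmaFilter_fst
  have hconc := tendsto_avg_abs_density (C := C)
  have hlim := (((hconc (i + 1)).const_mul (C.lip + C.bound)).add
    ((hconc i).const_mul C.lip)).add ((C.tendsto_err.comp hk').const_mul 2)
  simp only [mul_zero, add_zero] at hlim
  rw [tendsto_iff_norm_sub_tendsto_zero]
  refine squeeze_zero' (Eventually.of_forall fun _ => norm_nonneg _) ?_ hlim
  filter_upwards [hk'.eventually C.eventually_natDegree_lt] with x hx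
  have h1 : C.avg x.1 (C.gain i x.2) - C.limitGain i =
      C.avg x.1 (fun ω => C.gain i x.2 ω - C.limitGain i) := by
    rw [avg, avg, prodExpect_sub, prodExpect_const (C.sum_weight hx)]
  rw [Real.norm_eq_abs, h1]
  refine (abs_prodExpect_le (C.weight_nonneg _) _).trans
    ((prodExpect_mono (C.weight_nonneg _) (abs_gain_sub_le hx i x.2)).trans_eq ?_)
  rw [prodExpect_add, prodExpect_add, prodExpect_mul_left, prodExpect_mul_left,
    prodExpect_const (C.sum_weight hx)]
  rfl

lemma tendsto_avgNewDegreeOne (hP0 : C.P.coeff 0 = 0) (hP1 : C.P.coeff 1 = 0) (i : ℕ) :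
    Tendsto (fun k => avgNewDegreeOne (C.n k) C.g (C.m k) (C.M k) C.P (C.F k) i / C.n k) atTop
      (𝓝 (C.β * C.limitGain i)) := by
  have hgain := tendsto_avg_gain (C := C) i
  set y := C.limitGain i
  have hM := C.tendsto_M.mul_const y
  suffices h : Tendsto (fun k => avgNewDegreeOne (C.n k) C.g (C.m k) (C.M k) C.P (C.F k) i / C.n k -
      (C.M k : ℝ) / C.n k * y) atTop (𝓝 0) by simpa using h.add hM
  rw [tendsto_iff_eventually_abs_sub_le]
  intro ε hε
  have hβ := C.β_nonneg
  filter_upwards [tendsto_sigmaFilter.1 hgain (ε / (C.β + 1)) (by positivity),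
    C.eventually_natDegree_lt, C.tendsto_M.eventually_le_const (lt_add_one C.β)] with k h1 h2 h3
  have hn : (0 : ℝ) < C.n k := by exact_mod_cast (by omega : 0 < C.n k)
  have h4 : avgNewDegreeOne (C.n k) C.g (C.m k) (C.M k) C.P (C.F k) i / C.n k -
      (C.M k : ℝ) / C.n k * y - 0 = (∑ c : Fin (C.M k), (C.avg k (C.gain i c) - y)) / C.n k := by
    rw [avgNewDegreeOne_eq hP0 hP1 h2, Finset.sum_sub_distrib]
    simp only [Finset.sum_const, Finset.card_univ, Fintype.card_fin, nsmul_eq_mul]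
    ring
  rw [h4, abs_div, abs_of_pos hn, div_le_iff₀ hn]
  refine (Finset.abs_sum_le_sum_abs _ _).trans ((Finset.sum_le_card_nsmul _ _ (ε / (C.β + 1))
    fun c _ => h1 c trivial).trans ?_)
  rw [Finset.card_univ, Fintype.card_fin, nsmul_eq_mul]
  rw [div_le_iff₀ hn] at h3
  calc (C.M k : ℝ) * (ε / (C.β + 1)) ≤ ((C.β + 1) * C.n k) * (ε / (C.β + 1)) := by gcongr
    _ = ε * C.n k := by field_simp

/-- Division by `1 - x_j` cancels the same factor in `limitGain`, leaving increments of `β P'` that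
telescope from `P'(0) = 0`, the latter because there are no checks of degree one. -/
lemma tendsto_avgEffective (hP0 : C.P.coeff 0 = 0) (hP1 : C.P.coeff 1 = 0) (i : ℕ) :
    Tendsto (fun k => avgEffective (C.n k) C.g (C.m k) (C.M k) C.P (C.F k) i / C.n k) atTop
      (𝓝 (C.β * C.P.derivative.eval (C.limit i))) := by
  have h : ∀ j, Tendsto (fun k => avgNewDegreeOne (C.n k) C.g (C.m k) (C.M k) C.P (C.F k) j /
      C.n k / (1 - avgFullRank (C.n k) C.g (C.m k) (C.M k) C.P (C.F k) j)) atTop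
      (𝓝 (C.β * C.P.derivative.eval (C.limit (j + 1)) -
        C.β * C.P.derivative.eval (C.limit j))) := by
    intro j
    have hne : 1 - C.limit (j + 1) ≠ 0 := (sub_pos.2 (C.limit_mem (j + 1)).2).ne'
    have := (tendsto_avgNewDegreeOne hP0 hP1 j).div
      ((tendsto_avgFullRank hP0 hP1 j).const_sub 1) hne
    have hlim : C.β * C.limitGain j / (1 - C.limit (j + 1)) =
        C.β * C.P.derivative.eval (C.limit (j + 1)) - C.β * C.P.derivative.eval (C.limit j) := by
      rw [limitGain]
      field_simp
    rw [hlim] at this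
    exact this
  have hsum := tendsto_finsetSum (Finset.range i) fun j _ => h j
  rw [Finset.sum_range_sub (fun j => C.β * C.P.derivative.eval (C.limit j))] at hsum
  have h0 : C.P.derivative.eval (C.limit 0) = 0 := by
    simp [limit, ← coeff_zero_eq_eval_zero, coeff_derivative, hP1]
  rw [h0, mul_zero, sub_zero] at hsum
  refine hsum.congr fun k => ?_
  rw [avgEffective, Finset.sum_div]
  exact Finset.sum_congr rfl fun j _ => by rw [div_right_comm]

end CodeFamily

/-! ### Incomplete Gamma form and conclusion -/

lemma poissonTail_eq (g : ℕ) (x : ℝ) :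
    poissonTail g x = 1 - incGamma g x / (g - 1).factorial := by
  have h : ((g - 1).factorial : ℝ) ≠ 0 := by positivity
  rw [poissonTail, incGamma, ← Finset.mul_sum, mul_assoc, mul_div_cancel_left₀ _ h]

end GammaCode

theorem theorem1 (g : ℕ) (hg : 1 ≤ g)
    -- the check degree distribution
    (P : ℝ[X]) (hP : ∀ d, 0 ≤ P.coeff d) (hP0 : P.coeff 0 = 0) (hP1 : P.coeff 1 = 0)
    (hPsum : P.eval 1 = 1) (r₀ R : ℝ)
    -- a sequence of codes with `n k` generations over the finite field `F k`, with `K k`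
    -- information packets and `n k * g` outer coded packets, and with `m k` received packets
    (F : ℕ → Type*) [∀ k, Field (F k)] [∀ k, Fintype (F k)] (n m K : ℕ → ℕ)
    (hF : Tendsto (fun k => Fintype.card (F k)) atTop atTop)
    (hn : Tendsto n atTop atTop)
    (hm : Tendsto (fun k => (m k : ℝ) / n k) atTop (𝓝 r₀))
    (hKN : ∀ k, K k ≤ n k * g)
    (hK : Tendsto (fun k => (K k : ℝ) / (n k * g : ℕ)) atTop (𝓝 R)) :
    ∃ x : ℕ → ℝ,
      (∀ i, Tendsto (fun k =>
        GammaCode.avgFullRank (n k) g (m k) (n k * g - K k) P (F k) i) atTop (𝓝 (x i))) ∧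
      x 0 = 1 - GammaCode.incGamma g r₀ / (g - 1).factorial ∧
      (∀ i, 1 ≤ i → x i = 1 -
        GammaCode.incGamma g (r₀ + g * (1 - R) * P.derivative.eval (x (i - 1)))
          / (g - 1).factorial) ∧
      (∀ i, 1 ≤ i → Tendsto (fun k =>
          GammaCode.avgEffective (n k) g (m k) (n k * g - K k) P (F k) i / n k) atTop
        (𝓝 (g * (1 - R) * P.derivative.eval (x (i - 1))))) ∧
      (∀ i, 1 ≤ i → Tendsto (fun k =>
          GammaCode.avgEffective (n k) g (m k) (n k * g - K k) P (F k) i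
            * (1 - GammaCode.avgFullRank (n k) g (m k) (n k * g - K k) P (F k) i) / n k) atTop
        (𝓝 (g * (1 - R) * P.derivative.eval (x (i - 1)) * (1 - x i)))) := by
  have hM : Tendsto (fun k => ((n k * g - K k : ℕ) : ℝ) / n k) atTop (𝓝 (g * (1 - R))) := by
    refine ((hK.const_sub 1).const_mul (g : ℝ)).congr' ?_
    filter_upwards [hn.eventually_gt_atTop 0] with k hk
    have h1 : (n k : ℝ) ≠ 0 := by positivity
    have h2 : (g : ℝ) ≠ 0 := by positivity
    rw [Nat.cast_sub (hKN k)]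
    push_cast
    field_simp
  let C : GammaCode.CodeFamily :=
    { g := g, one_le_g := hg, P := P, coeff_nonneg := hP, eval_one := hPsum, F := F, n := n, m := m,
      M := fun k => n k * g - K k, r := r₀, β := g * (1 - R), tendsto_card := hF, tendsto_n := hn,
      tendsto_m := hm, tendsto_M := hM }
  have hX := GammaCode.CodeFamily.tendsto_avgFullRank (C := C) hP0 hP1
  have hE := GammaCode.CodeFamily.tendsto_avgEffective (C := C) hP0 hP1
  -- The shift reflects that iteration `0` already counts as the first peeling round. For `i = 0`
  -- the checks drop out of the rate since `P'(0) = 0`.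
  refine ⟨fun i => C.limit (i + 1), hX, ?_, fun i hi => ?_, fun i hi => ?_, fun i hi => ?_⟩
  · have h0 : P.derivative.eval 0 = 0 := by
      simp [← coeff_zero_eq_eval_zero, coeff_derivative, hP1]
    rw [← GammaCode.poissonTail_eq]
    change GammaCode.poissonTail g (r₀ + g * (1 - R) * P.derivative.eval 0) = _
    rw [h0, mul_zero, add_zero]
  · simp only [Nat.sub_add_cancel hi]
    rw [← GammaCode.poissonTail_eq]
    rfl
  · simp only [Nat.sub_add_cancel hi]
    exact hE i
  · simp only [Nat.sub_add_cancel hi]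
    exact ((hE i).mul ((hX i).const_sub 1)).congr fun k => by ring
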